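/- **Theorem 2.1.** Let $\Omega\subset\mathbb R^m$, $m\in\{2,3\}$, be a bounded domain with Lipschitz boundary and unit outward normal $\mathbf n$. Let $\nu,\lambda,\gamma,\varepsilon,T>0$, let $N\ge1$ be an integer, $\Delta t=T/N$ and $t^n=n\Delta t$. Write $\|\cdot\|$ for the $L^2(\Omega)$ norm of scalar, vector and tensor fields, and, for a sequence $a$, $\tilde a^{n+1}=2a^n-a^{n-1}$ and $\delta a^{n+1}=\frac{3a^{n+1}-4a^n+a^{n-1}}{2\Delta t}$. Suppose that the vector fields $\mathbf u^n,\mathbf u_*^n,\mathbf d^n,\mathbf w^n:\Omega\to\mathbb R^m$, the scalar fields $p^n,q^n:\Omega\to\mathbb R$ and the numbers $s^n\in\mathbb R$ satisfy, for every $1\le n\le N-1$, the second-order PCSAV scheme $$\delta\mathbf d^{n+1}+\frac{s^{n+1}}{\exp(-t^{n+1}/T)}\,\tilde{\mathbf u}^{n+1}\cdot\nabla\tilde{\mathbf d}^{n+1}+\gamma\mathbf w^{n+1}=0,$$ $$\mathbf w^{n+1}=-\Delta\mathbf d^{n+1}+q^{n+1}\tilde{\mathbf d}^{n+1},\qquad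 \partial_{\mathbf n}\mathbf d^{n+1}|_{\partial\Omega}=0,$$ $$\delta q^{n+1}=\frac{2}{\varepsilon^2}(\tilde{\mathbf d}^{n+1})^t\,\delta\mathbf d^{n+1},$$ $$\frac{3\mathbf u_*^{n+1}-4\mathbf u^n+\mathbf u^{n-1}}{2\Delta t}+(\tilde{\mathbf u}^{n+1}\cdot\nabla)\mathbf u_*^{n+1}+\tfrac12(\nabla\cdot\tilde{\mathbf u}^{n+1})\mathbf u_*^{n+1}-\nu\Delta\mathbf u_*^{n+1}+\nabla p^n=\lambda\frac{s^{n+1}}{\exp(-t^{n+1}/T)}(\nabla\tilde{\mathbf d}^{n+1})^t\tilde{\mathbf w}^{n+1},\qquad \mathbf u_*^{n+1}|_{\partial\Omega}=0,$$ $$\frac{3\mathbf u^{n+1}-3\mathbf u_*^{n+1}}{2\Delta t}+\nabla\bigl(p^{n+1}-p^n+\nu\nabla\cdot\mathbf u_*^{n+1}\bigr)=0,\qquad \nabla\cdot\mathbf u^{n+1}=0,\qquad \mathbf u^{n+1}\cdot\mathbf n|_{\partial\Omega}=0,$$ $$\delta s^{n+1}=-\frac{s^{n+1}}T+\frac1{\exp(-t^{n+1}/T)}\int_\Omega(\tilde{\mathbf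 u}^{n+1}\cdot\nabla\tilde{\mathbf d}^{n+1})\cdot\mathbf w^{n+1}\,d\mathbf x-\frac1{\exp(-t^{n+1}/T)}\int_\Omega(\mathbf u_*^{n+1}\cdot\nabla\tilde{\mathbf d}^{n+1})\cdot\tilde{\mathbf w}^{n+1}\,d\mathbf x .$$ The equations are understood in the weak sense: $\mathbf d^n\in H^1(\Omega)^m$; $\mathbf w^n,p^n,q^n\in L^2(\Omega)$; $\mathbf u_*^n\in H_0^1(\Omega)^m$ for $n\ge1$; $\mathbf u^n\in H(\mathrm{div},\Omega)$; $p^{n+1}-p^n+\nu\nabla\cdot\mathbf u_*^{n+1}\in H^1(\Omega)$; the equation for $\mathbf w^{n+1}$, with its Neumann condition, is tested with $H^1(\Omega)^m$, the one for $\mathbf u_*^{n+1}$ with $H_0^1(\Omega)^m$, the products in these weak forms and in the equation for $s^{n+1}$ being integrable; the condition on $\mathbf u^{n+1}\cdot\mathbf n$ is that of the normal trace in $H(\mathrm{div},\Omega)$; the other equations hold almost everywhere. The data at the levels $0$ and $1$ are arbitrary in these spaces, subject to $\nabla\cdot\mathbf u^n=0$ and $\mathbf u^n\cdot\mathbf n|_{\partial\Omega}=0$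 for $n=0,1$ and to $H^1\in H^1(\Omega)$ for the function $H^1$ (superscript $n=1$) defined next. Put $$g^0=0,\qquad g^{n+1}=\nu\nabla\cdot\mathbf u_*^{n+1}+g^n,\qquad H^n=p^n+g^n,$$ $$\begin{aligned}W^*_n={}&\tfrac12\|\mathbf u^n\|^2+\tfrac12\|2\mathbf u^n-\mathbf u^{n-1}\|^2+\tfrac23\Delta t^2\|\nabla H^n\|^2+\nu^{-1}\Delta t\|g^n\|^2+\tfrac\lambda2\|\nabla\mathbf d^n\|^2+\tfrac\lambda2\|\nabla(2\mathbf d^n-\mathbf d^{n-1})\|^2\\&+\tfrac{\lambda\varepsilon^2}4\|q^n\|^2+\tfrac{\lambda\varepsilon^2}4\|2q^n-q^{n-1}\|^2+\tfrac\lambda2|s^n|^2+\tfrac\lambda2|2s^n-s^{n-1}|^2 .\end{aligned}$$ Then $H^n$ belongs to the Sobolev space $H^1(\Omega)$ for $1\le n\le N$ and, without any restriction on $\Delta t$, for every $1\le n\le N-1$, $$W^*_{n+1}-W^*_n\le-2\Delta t\,\lambda\gamma\|\mathbf w^{n+1}\|^2-\nu\Delta t\|\nabla\mathbf u_*^{n+1}\|^2-\nu\Delta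 t\|\nabla\times\mathbf u_*^{n+1}\|^2-\frac{2\Delta t}{T}\lambda|s^{n+1}|^2 .$$ -/

import Mathlib

open MeasureTheory Filter Topology

noncomputable section

namespace PCSAV

/-- Physical space `ℝ^m` with its Euclidean norm and Lebesgue measure. -/
abbrev Pt (m : ℕ) : Type := EuclideanSpace ℝ (Fin m)

variable {m : ℕ}

section Sobolev

/-- Smooth real functions on `ℝ^m` whose support is a compact subset of `Ω`. -/
structure IsTest (Ω : Set (Pt m)) (φ : Pt m → ℝ) : Prop where
  smooth : ContDiff ℝ (⊤ : ℕ∞) φ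
  compact : HasCompactSupport φ
  supp : tsupport φ ⊆ Ω

/-- The classical partial derivative `∂ᵢ φ`. -/
def partialDeriv (i : Fin m) (φ : Pt m → ℝ) (x : Pt m) : ℝ :=
  fderiv ℝ φ x (EuclideanSpace.single i (1 : ℝ))

/-- `f ∈ L²(Ω)`, for scalar or vector valued `f`. -/
def MemL2 {F : Type*} [NormedAddCommGroup F] (Ω : Set (Pt m)) (f : Pt m → F) : Prop :=
  MemLp f 2 (volume.restrict Ω)

/-- `‖f‖²`, the square of the `L²(Ω)` norm, for scalar or vector valued `f`. -/
def normSq {F : Type*} [NormedAddCommGroup F] (Ω : Set (Pt m)) (f : Pt m → F) : ℝ :=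
  ∫ x in Ω, ‖f x‖ ^ 2

/-- `g` is the weak partial derivative `∂ᵢ f` in `Ω`. -/
def HasWeakPartial (Ω : Set (Pt m)) (i : Fin m) (f g : Pt m → ℝ) : Prop :=
  ∀ φ : Pt m → ℝ, IsTest Ω φ →
    ∫ x in Ω, f x * partialDeriv i φ x = -∫ x in Ω, g x * φ x

/-- `g` is the weak divergence `∇·v` in `Ω`. -/
def HasWeakDiv (Ω : Set (Pt m)) (v : Pt m → Pt m) (g : Pt m → ℝ) : Prop :=
  ∀ φ : Pt m → ℝ, IsTest Ω φ →
    ∫ x in Ω, ∑ i, v x i * partialDeriv i φ x = -∫ x in Ω, g x * φ x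

open Classical in
/-- The weak partial derivative `∂ᵢ f ∈ L²(Ω)` (unique up to null sets; `0` if there is none). -/
def weakPartial (Ω : Set (Pt m)) (i : Fin m) (f : Pt m → ℝ) : Pt m → ℝ :=
  if h : ∃ g, MemL2 Ω g ∧ HasWeakPartial Ω i f g then h.choose else 0

open Classical in
/-- The weak divergence `∇·v ∈ L²(Ω)` (unique up to null sets; `0` if there is none). -/
def weakDiv (Ω : Set (Pt m)) (v : Pt m → Pt m) : Pt m → ℝ :=
  if h : ∃ g, MemL2 Ω g ∧ HasWeakDiv Ω v g then h.choose else 0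

/-- The Sobolev space `H¹(Ω)`. -/
def MemH1 (Ω : Set (Pt m)) (f : Pt m → ℝ) : Prop :=
  MemL2 Ω f ∧ ∀ i, ∃ g, MemL2 Ω g ∧ HasWeakPartial Ω i f g

/-- The Sobolev space `H₀¹(Ω)`, the closure of the test functions in `H¹(Ω)`. -/
def MemH10 (Ω : Set (Pt m)) (f : Pt m → ℝ) : Prop :=
  MemH1 Ω f ∧ ∃ φ : ℕ → Pt m → ℝ, (∀ k, IsTest Ω (φ k)) ∧
    Tendsto (fun k => eLpNorm (fun x => φ k x - f x) 2 (volume.restrict Ω)) atTop (𝓝 0) ∧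
    ∀ i, Tendsto (fun k => eLpNorm (fun x => partialDeriv i (φ k) x - weakPartial Ω i f x) 2
      (volume.restrict Ω)) atTop (𝓝 0)

/-- The vector valued space `H¹(Ω)^m`. -/
def VecH1 (Ω : Set (Pt m)) (v : Pt m → Pt m) : Prop := ∀ i, MemH1 Ω (fun x => v x i)

/-- The vector valued space `H₀¹(Ω)^m`. -/
def VecH10 (Ω : Set (Pt m)) (v : Pt m → Pt m) : Prop := ∀ i, MemH10 Ω (fun x => v x i)

/-- `H(div, Ω)`: the `L²` vector fields with a weak divergence in `L²`. -/
def MemHdiv (Ω : Set (Pt m)) (v : Pt m → Pt m) : Prop :=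
  MemL2 Ω v ∧ ∃ g, MemL2 Ω g ∧ HasWeakDiv Ω v g

/-- `v·n = 0` on `∂Ω` for `v ∈ H(div, Ω)`: the boundary term `∫_∂Ω φ v·n` of Green's formula
vanishes for every `φ ∈ H¹(Ω)`. -/
def NormalTraceZero (Ω : Set (Pt m)) (v : Pt m → Pt m) : Prop :=
  ∀ φ : Pt m → ℝ, MemH1 Ω φ →
    (∫ x in Ω, ∑ i, v x i * weakPartial Ω i φ x) + ∫ x in Ω, weakDiv Ω v x * φ x = 0

/-- The entry `∂ⱼ vᵢ` of the weak Jacobian `∇v`. -/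
def jac (Ω : Set (Pt m)) (v : Pt m → Pt m) (i j : Fin m) : Pt m → ℝ :=
  weakPartial Ω j (fun x => v x i)

/-- `(a·∇)v`, with `i`-th component `∑ⱼ aⱼ ∂ⱼ vᵢ`. -/
def advect (Ω : Set (Pt m)) (a v : Pt m → Pt m) (x : Pt m) : Pt m :=
  WithLp.toLp 2 fun i => ∑ j, a x j * jac Ω v i j x

/-- `(∇v)ᵗ w`, with `j`-th component `∑ᵢ ∂ⱼ vᵢ wᵢ`. -/
def jacTMul (Ω : Set (Pt m)) (v w : Pt m → Pt m) (x : Pt m) : Pt m :=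
  WithLp.toLp 2 fun j => ∑ i, jac Ω v i j x * w x i

/-- `‖∇f‖²` for a scalar field. -/
def gradNormSq (Ω : Set (Pt m)) (f : Pt m → ℝ) : ℝ := ∑ i, normSq Ω (weakPartial Ω i f)

/-- `‖∇v‖²` for a vector field. -/
def jacNormSq (Ω : Set (Pt m)) (v : Pt m → Pt m) : ℝ := ∑ i, ∑ j, normSq Ω (jac Ω v i j)

/-- `‖∇×v‖²`: the sum over `i < j` of `‖∂ᵢ vⱼ - ∂ⱼ vᵢ‖²`. -/
def curlNormSq (Ω : Set (Pt m)) (v : Pt m → Pt m) : ℝ :=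
  ∑ i, ∑ j ∈ Finset.Ioi i, normSq Ω (fun x => jac Ω v j i x - jac Ω v i j x)

/-- In the plane the curl is the scalar `∂₁v₂ - ∂₂v₁`. -/
theorem curlNormSq_two (Ω : Set (Pt 2)) (v : Pt 2 → Pt 2) :
    curlNormSq Ω v = normSq Ω (fun x => jac Ω v 1 0 x - jac Ω v 0 1 x) := by
  have h0 : Finset.Ioi (0 : Fin 2) = {1} := by decide
  have h1 : Finset.Ioi (1 : Fin 2) = ∅ := by decide
  simp [curlNormSq, Fin.sum_univ_two, h0, h1]

/-- In space the curl is `(∂₂v₃ - ∂₃v₂, ∂₃v₁ - ∂₁v₃, ∂₁v₂ - ∂₂v₁)`. -/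
theorem curlNormSq_three (Ω : Set (Pt 3)) (v : Pt 3 → Pt 3) :
    curlNormSq Ω v = normSq Ω (fun x => jac Ω v 2 1 x - jac Ω v 1 2 x)
      + normSq Ω (fun x => jac Ω v 0 2 x - jac Ω v 2 0 x)
      + normSq Ω (fun x => jac Ω v 1 0 x - jac Ω v 0 1 x) := by
  have h0 : Finset.Ioi (0 : Fin 3) = {1, 2} := by decide
  have h1 : Finset.Ioi (1 : Fin 3) = {2} := by decide
  have h2 : Finset.Ioi (2 : Fin 3) = ∅ := by decide
  have hs : normSq Ω (fun x => jac Ω v 2 0 x - jac Ω v 0 2 x)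
      = normSq Ω (fun x => jac Ω v 0 2 x - jac Ω v 2 0 x) := by
    simp only [normSq, norm_sub_rev]
  simp only [curlNormSq, Fin.sum_univ_three, h0, h1, h2, Finset.sum_empty, Finset.sum_singleton,
    Finset.sum_pair (show (1 : Fin 3) ≠ 2 by decide), hs]
  ring

end Sobolev

section Scheme

/-- The constants: viscosity `ν`, elasticity `lam` (the `λ` of the model), relaxation `γ`,
penalty `ε`, final time `T`, and the number `N` of time steps. -/
structure Params where
  ν : ℝ
  lam : ℝ
  γ : ℝ
  ε : ℝ
  T : ℝ
  N : ℕ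

/-- The time step `Δt = T / N`. -/
def Params.dt (P : Params) : ℝ := P.T / P.N

/-- The grid point `tⁿ = n Δt`. -/
def Params.t (P : Params) (n : ℕ) : ℝ := n * P.dt

/-- The discrete unknowns at the time levels `n = 0, 1, …, N`. -/
structure Iterates (m : ℕ) where
  u : ℕ → Pt m → Pt m
  ustar : ℕ → Pt m → Pt m
  d : ℕ → Pt m → Pt m
  w : ℕ → Pt m → Pt m
  p : ℕ → Pt m → ℝ
  q : ℕ → Pt m → ℝ
  s : ℕ → ℝ

/-- `2 aⁿ - aⁿ⁻¹`, the extrapolation to the level `n + 1` (used for `1 ≤ n`). -/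
def extrap {V : Type*} [AddCommGroup V] [Module ℝ V] (a : ℕ → V) (n : ℕ) : V :=
  (2 : ℝ) • a n - a (n - 1)

/-- The BDF2 quotient `(3a - 4b + c) / (2Δt)`. -/
def bdf2 {V : Type*} [AddCommGroup V] [Module ℝ V] (dt : ℝ) (a b c : V) : V :=
  (2 * dt)⁻¹ • ((3 : ℝ) • a - (4 : ℝ) • b + c)

/-- The SAV ratio `sⁿ / exp(-tⁿ/T)`. -/
def savRatio (P : Params) (s : ℕ → ℝ) (n : ℕ) : ℝ := s n / Real.exp (-(P.t n) / P.T)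

/-- `g⁰ = 0`, `gⁿ⁺¹ = ν ∇·u_*ⁿ⁺¹ + gⁿ`. -/
def gSeq (Ω : Set (Pt m)) (ν : ℝ) (ustar : ℕ → Pt m → Pt m) : ℕ → Pt m → ℝ
  | 0 => 0
  | n + 1 => fun x => ν * weakDiv Ω (ustar (n + 1)) x + gSeq Ω ν ustar n x

/-- `Hⁿ = pⁿ + gⁿ`. -/
def hSeq (Ω : Set (Pt m)) (ν : ℝ) (ustar : ℕ → Pt m → Pt m) (p : ℕ → Pt m → ℝ) (n : ℕ) :
    Pt m → ℝ :=
  fun x => p n x + gSeq Ω ν ustar n x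

/-- Transport equation for the director, almost everywhere in `Ω`:
`(3dⁿ⁺¹ - 4dⁿ + dⁿ⁻¹)/(2Δt) + (sⁿ⁺¹/exp(-tⁿ⁺¹/T)) ũ·∇d̃ + γ wⁿ⁺¹ = 0`. -/
def DirectorEq (Ω : Set (Pt m)) (P : Params) (X : Iterates m) (n : ℕ) : Prop :=
  ∀ᵐ x ∂(volume.restrict Ω),
    bdf2 P.dt (X.d (n + 1) x) (X.d n x) (X.d (n - 1) x)
      + savRatio P X.s (n + 1) • advect Ω (extrap X.u n) (extrap X.d n) x
      + P.γ • X.w (n + 1) x = 0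

/-- Weak form of `wⁿ⁺¹ = -Δdⁿ⁺¹ + qⁿ⁺¹ d̃` in `Ω`, `∂ₙ dⁿ⁺¹ = 0` on `∂Ω`. -/
def PotentialEq (Ω : Set (Pt m)) (X : Iterates m) (n : ℕ) : Prop :=
  ∀ ψ : Pt m → Pt m, VecH1 Ω ψ →
    IntegrableOn (fun x => X.q (n + 1) x * inner ℝ (extrap X.d n x) (ψ x)) Ω ∧
    ∫ x in Ω, inner ℝ (X.w (n + 1) x) (ψ x)
      = (∑ i, ∑ j, ∫ x in Ω, jac Ω (X.d (n + 1)) i j x * jac Ω ψ i j x)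
        + ∫ x in Ω, X.q (n + 1) x * inner ℝ (extrap X.d n x) (ψ x)

/-- Equation for the multiplier, almost everywhere in `Ω`:
`(3qⁿ⁺¹ - 4qⁿ + qⁿ⁻¹)/(2Δt) = (2/ε²) d̃ · (3dⁿ⁺¹ - 4dⁿ + dⁿ⁻¹)/(2Δt)`. -/
def MultiplierEq (Ω : Set (Pt m)) (P : Params) (X : Iterates m) (n : ℕ) : Prop :=
  ∀ᵐ x ∂(volume.restrict Ω),
    bdf2 P.dt (X.q (n + 1) x) (X.q n x) (X.q (n - 1) x)
      = 2 / P.ε ^ 2 * inner ℝ (extrap X.d n x)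
          (bdf2 P.dt (X.d (n + 1) x) (X.d n x) (X.d (n - 1) x))

/-- Weak form, with test fields in `H₀¹(Ω)^m`, of the momentum equation
`(3u_*ⁿ⁺¹ - 4uⁿ + uⁿ⁻¹)/(2Δt) + (ũ·∇)u_*ⁿ⁺¹ + ½(∇·ũ)u_*ⁿ⁺¹ - νΔu_*ⁿ⁺¹ + ∇pⁿ
  = λ (sⁿ⁺¹/exp(-tⁿ⁺¹/T)) (∇d̃)ᵗ w̃`. -/
def MomentumEq (Ω : Set (Pt m)) (P : Params) (X : Iterates m) (n : ℕ) : Prop :=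
  ∀ v : Pt m → Pt m, VecH10 Ω v →
    IntegrableOn (fun x => inner ℝ (advect Ω (extrap X.u n) (X.ustar (n + 1)) x) (v x)) Ω ∧
    IntegrableOn (fun x => weakDiv Ω (extrap X.u n) x * inner ℝ (X.ustar (n + 1) x) (v x)) Ω ∧
    IntegrableOn (fun x => inner ℝ (jacTMul Ω (extrap X.d n) (extrap X.w n) x) (v x)) Ω ∧
    (∫ x in Ω, inner ℝ (bdf2 P.dt (X.ustar (n + 1) x) (X.u n x) (X.u (n - 1) x)) (v x))
      + (∫ x in Ω, inner ℝ (advect Ω (extrap X.u n) (X.ustar (n + 1)) x) (v x))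
      + 1 / 2 * (∫ x in Ω, weakDiv Ω (extrap X.u n) x * inner ℝ (X.ustar (n + 1) x) (v x))
      + P.ν * (∑ i, ∑ j, ∫ x in Ω, jac Ω (X.ustar (n + 1)) i j x * jac Ω v i j x)
      - (∫ x in Ω, X.p n x * weakDiv Ω v x)
    = P.lam * savRatio P X.s (n + 1)
        * ∫ x in Ω, inner ℝ (jacTMul Ω (extrap X.d n) (extrap X.w n) x) (v x)

/-- Projection step: `φ = pⁿ⁺¹ - pⁿ + ν∇·u_*ⁿ⁺¹` belongs to `H¹(Ω)` and
`(3uⁿ⁺¹ - 3u_*ⁿ⁺¹)/(2Δt) + ∇φ = 0` almost everywhere in `Ω`. -/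
def ProjectionEq (Ω : Set (Pt m)) (P : Params) (X : Iterates m) (n : ℕ) : Prop :=
  let φ : Pt m → ℝ := fun x => X.p (n + 1) x - X.p n x + P.ν * weakDiv Ω (X.ustar (n + 1)) x
  MemH1 Ω φ ∧ ∀ i, ∀ᵐ x ∂(volume.restrict Ω),
    (3 * X.u (n + 1) x i - 3 * X.ustar (n + 1) x i) / (2 * P.dt) + weakPartial Ω i φ x = 0

/-- Equation for the scalar auxiliary variable. -/
def SavEq (Ω : Set (Pt m)) (P : Params) (X : Iterates m) (n : ℕ) : Prop :=
  IntegrableOn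
    (fun x => inner ℝ (advect Ω (extrap X.u n) (extrap X.d n) x) (X.w (n + 1) x)) Ω ∧
  IntegrableOn
    (fun x => inner ℝ (advect Ω (X.ustar (n + 1)) (extrap X.d n) x) (extrap X.w n x)) Ω ∧
  bdf2 P.dt (X.s (n + 1)) (X.s n) (X.s (n - 1))
    = -(X.s (n + 1) / P.T)
      + 1 / Real.exp (-(P.t (n + 1)) / P.T)
        * (∫ x in Ω, inner ℝ (advect Ω (extrap X.u n) (extrap X.d n) x) (X.w (n + 1) x))
      - 1 / Real.exp (-(P.t (n + 1)) / P.T)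
        * ∫ x in Ω, inner ℝ (advect Ω (X.ustar (n + 1)) (extrap X.d n) x) (extrap X.w n x)

/-- `∇·v = 0` in `Ω` and `v·n = 0` on `∂Ω`. -/
def Incompressible (Ω : Set (Pt m)) (v : Pt m → Pt m) : Prop :=
  MemHdiv Ω v ∧ (∀ᵐ x ∂(volume.restrict Ω), weakDiv Ω v x = 0) ∧ NormalTraceZero Ω v

/-- `X` is produced by the scheme on `0 ≤ n ≤ N`. The levels `0` and `1` are given starting values;
they are only required to lie in the same function spaces as the later levels, with incompressible
velocities. -/
structure IsSolution (Ω : Set (Pt m)) (P : Params) (X : Iterates m) : Prop where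
  d_mem : ∀ n ≤ P.N, VecH1 Ω (X.d n)
  w_mem : ∀ n ≤ P.N, MemL2 Ω (X.w n)
  q_mem : ∀ n ≤ P.N, MemL2 Ω (X.q n)
  p_mem : ∀ n ≤ P.N, MemL2 Ω (X.p n)
  ustar_mem : ∀ n, 1 ≤ n → n ≤ P.N → VecH10 Ω (X.ustar n)
  h_start : MemH1 Ω (hSeq Ω P.ν X.ustar X.p 1)
  incompressible : ∀ n ≤ P.N, Incompressible Ω (X.u n)
  director : ∀ n, 1 ≤ n → n + 1 ≤ P.N → DirectorEq Ω P X n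
  potential : ∀ n, 1 ≤ n → n + 1 ≤ P.N → PotentialEq Ω X n
  multiplier : ∀ n, 1 ≤ n → n + 1 ≤ P.N → MultiplierEq Ω P X n
  momentum : ∀ n, 1 ≤ n → n + 1 ≤ P.N → MomentumEq Ω P X n
  projection : ∀ n, 1 ≤ n → n + 1 ≤ P.N → ProjectionEq Ω P X n
  sav : ∀ n, 1 ≤ n → n + 1 ≤ P.N → SavEq Ω P X n

/-- The modified discrete energy `W*` at the level `n` (used for `1 ≤ n`). -/
def energy (Ω : Set (Pt m)) (P : Params) (X : Iterates m) (n : ℕ) : ℝ :=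
  1 / 2 * normSq Ω (X.u n) + 1 / 2 * normSq Ω (extrap X.u n)
    + 2 / 3 * P.dt ^ 2 * gradNormSq Ω (hSeq Ω P.ν X.ustar X.p n)
    + P.ν⁻¹ * P.dt * normSq Ω (gSeq Ω P.ν X.ustar n)
    + P.lam / 2 * jacNormSq Ω (X.d n) + P.lam / 2 * jacNormSq Ω (extrap X.d n)
    + P.lam * P.ε ^ 2 / 4 * normSq Ω (X.q n) + P.lam * P.ε ^ 2 / 4 * normSq Ω (extrap X.q n)
    + P.lam / 2 * |X.s n| ^ 2 + P.lam / 2 * |extrap X.s n| ^ 2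

end Scheme

end PCSAV

end

/-! The proof is an energy argument: each equation is tested with the quantity that turns its BDF2
quotient into an energy difference. The momentum equation is tested with `2Δt u_*`, the transport
equation with `2Δt λ w`, the equation for `w` with `δd`, and the `s` equation is multiplied by `2Δt
λ s`. The multiplier equation replaces `q d̃·δd` by `(ε²/2) q δq`. The identity `2(3a - 4b + c)·a =
|a|² + |2a - b|² - |b|² - |2b - c|² + |a - 2b + c|²` yields the differences, and its last square is
dropped (`le_integral_inner_bdf2`).

The couplings have no sign, but they cancel. The transport work in `director_le` and the elastic
work in `momentum_le` are, after multiplication by `s/exp`, exactly the two integrals in `sav_le`.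

The explicit pressure is handled through `H` and `g`. The projection step reads `u_* = u +
(2Δt/3)∇(Hⁿ⁺¹ - Hⁿ)`, and `u` is orthogonal to gradients. Hence the velocity splitting produces
`(4Δt²/3)‖∇(Hⁿ⁺¹ - Hⁿ)‖²`, while the `H` part of the pressure work costs only half of it beyond the
telescoping `‖∇H‖²`. The `g` part telescopes up to `νΔt‖∇·u_*‖²`, which the viscous term
`2νΔt‖∇u_*‖²` absorbs: on `H₀¹` one has `‖∇u_*‖² = ‖∇·u_*‖² + ‖∇×u_*‖²` (`VecH10.jacNormSq_eq`).

The analytic difficulty is convection: `ũ` is merely square integrable and `u_*` merely `H₀¹`, so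
`ũ·∇u_*` cannot be paired with `u_*` by density. `integral_transport_mul_self_eq_zero` gets round
this with bounded nonlinear truncations and the assumed integrability of the product. -/

namespace PCSAV

variable {m : ℕ} {Ω : Set (Pt m)}

/-! ### Square integrable fields and the BDF2 polarization identity -/

section SquareIntegrable

variable {F : Type*} [NormedAddCommGroup F]

theorem MemL2.add {f g : Pt m → F} (hf : MemL2 Ω f) (hg : MemL2 Ω g) :
    MemL2 Ω (fun x => f x + g x) := MemLp.add hf hg

theorem MemL2.sub {f g : Pt m → F} (hf : MemL2 Ω f) (hg : MemL2 Ω g) :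
    MemL2 Ω (fun x => f x - g x) := MemLp.sub hf hg

theorem MemL2.smul [InnerProductSpace ℝ F] {f : Pt m → F} (c : ℝ) (hf : MemL2 Ω f) :
    MemL2 Ω (fun x => c • f x) := MemLp.const_smul hf c

theorem MemL2.mul_left {f : Pt m → ℝ} (c : ℝ) (hf : MemL2 Ω f) :
    MemL2 Ω (fun x => c * f x) := MemLp.const_mul hf c

theorem MemL2.comp {v : Pt m → Pt m} (hv : MemL2 Ω v) (i : Fin m) :
    MemL2 Ω (fun x => v x i) := MemLp.eval_piLp hv i

theorem memL2_of_comp {v : Pt m → Pt m} (hv : ∀ i, MemL2 Ω (fun x => v x i)) :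
    MemL2 Ω v := MemLp.of_eval_piLp hv

theorem MemL2.sum {ι : Type*} (s : Finset ι) {f : ι → Pt m → ℝ} (hf : ∀ i ∈ s, MemL2 Ω (f i)) :
    MemL2 Ω (fun x => ∑ i ∈ s, f i x) := memLp_finsetSum s hf

theorem MemL2.integrable_inner [InnerProductSpace ℝ F] {f g : Pt m → F} (hf : MemL2 Ω f)
    (hg : MemL2 Ω g) : Integrable (fun x => inner ℝ (f x) (g x)) (volume.restrict Ω) := by
  have h : Integrable ((fun x => ‖f x‖) * fun x => ‖g x‖) (volume.restrict Ω) :=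
    MemLp.integrable_mul (MemLp.norm hf) (MemLp.norm hg)
  refine h.mono (hf.1.inner hg.1) (ae_of_all _ fun x => ?_)
  simpa using abs_real_inner_le_norm (f x) (g x)

theorem MemL2.integrable_mul {f g : Pt m → ℝ} (hf : MemL2 Ω f) (hg : MemL2 Ω g) :
    Integrable (fun x => f x * g x) (volume.restrict Ω) :=
  MemLp.integrable_mul hf hg

theorem MemL2.integrable_norm_sq {f : Pt m → F} (hf : MemL2 Ω f) :
    Integrable (fun x => ‖f x‖ ^ 2) (volume.restrict Ω) :=
  (memLp_two_iff_integrable_sq_norm hf.1).1 hf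

theorem normSq_nonneg (f : Pt m → F) : 0 ≤ normSq Ω f :=
  integral_nonneg fun _ => by positivity

theorem normSq_congr {f g : Pt m → F} (h : f =ᵐ[volume.restrict Ω] g) :
    normSq Ω f = normSq Ω g :=
  integral_congr_ae <| h.mono fun x hx => by simp only [hx]

theorem normSq_eq_integral_mul (f : Pt m → ℝ) : normSq Ω f = ∫ x in Ω, f x * f x := by
  simp [normSq, pow_two]

/-- Polarization of the three-level difference quotient. -/
theorem integral_inner_three_level [InnerProductSpace ℝ F] {a b c : Pt m → F} (ha : MemL2 Ω a)
    (hb : MemL2 Ω b) (hc : MemL2 Ω c) :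
    ∫ x in Ω, inner ℝ ((3 : ℝ) • a x - (4 : ℝ) • b x + c x) (a x)
      = 1 / 2 * (normSq Ω a + normSq Ω (fun x => (2 : ℝ) • a x - b x)
          - normSq Ω b - normSq Ω (fun x => (2 : ℝ) • b x - c x)
          + normSq Ω (fun x => a x - (2 : ℝ) • b x + c x)) := by
  have h1 := ha.integrable_norm_sq
  have h2 := ((ha.smul 2).sub hb).integrable_norm_sq
  have h3 := hb.integrable_norm_sq
  have h4 := ((hb.smul 2).sub hc).integrable_norm_sq
  have h5 := ((ha.sub (hb.smul 2)).add hc).integrable_norm_sq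
  have h12 : Integrable (fun x => ‖a x‖ ^ 2 + ‖(2 : ℝ) • a x - b x‖ ^ 2) (volume.restrict Ω) :=
    h1.add h2
  have h123 : Integrable (fun x => ‖a x‖ ^ 2 + ‖(2 : ℝ) • a x - b x‖ ^ 2 - ‖b x‖ ^ 2)
    (volume.restrict Ω) := h12.sub h3
  have h1234 : Integrable (fun x => ‖a x‖ ^ 2 + ‖(2 : ℝ) • a x - b x‖ ^ 2 - ‖b x‖ ^ 2
    - ‖(2 : ℝ) • b x - c x‖ ^ 2) (volume.restrict Ω) := h123.sub h4
  simp only [normSq]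
  rw [← integral_add h1 h2, ← integral_sub h12 h3, ← integral_sub h123 h4,
    ← integral_add h1234 h5, ← integral_const_mul]
  congr 1 with x
  simp only [← real_inner_self_eq_norm_sq, inner_add_left, inner_sub_left, inner_add_right,
    inner_sub_right, inner_smul_left, inner_smul_right, real_inner_comm (a x),
    real_inner_comm (b x) (c x), RCLike.conj_to_real]
  ring

/-- This makes explicitly treated terms telescope; it is applied to `g` and to `∇H`. -/
theorem two_mul_integral_inner_sub [InnerProductSpace ℝ F] {a b : Pt m → F} (ha : MemL2 Ω a)
    (hb : MemL2 Ω b) :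
    2 * ∫ x in Ω, inner ℝ (b x) (a x - b x)
      = normSq Ω a - normSq Ω b - normSq Ω (fun x => a x - b x) := by
  have h1 := ha.integrable_norm_sq
  have h2 := hb.integrable_norm_sq
  have h12 : Integrable (fun x => ‖a x‖ ^ 2 - ‖b x‖ ^ 2) (volume.restrict Ω) := h1.sub h2
  simp only [normSq]
  rw [← integral_const_mul, ← integral_sub h1 h2,
    ← integral_sub h12 (ha.sub hb).integrable_norm_sq]
  congr 1 with x
  simp only [← real_inner_self_eq_norm_sq, inner_sub_left, inner_sub_right,
    real_inner_comm (a x) (b x)]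
  ring

/-- Energy estimate for the BDF2 quotient. -/
theorem le_integral_inner_bdf2 [InnerProductSpace ℝ F] {a b c : Pt m → F} (ha : MemL2 Ω a)
    (hb : MemL2 Ω b) (hc : MemL2 Ω c) {dt : ℝ} (hdt : 0 < dt) :
    1 / 2 * (normSq Ω a + normSq Ω (fun x => (2 : ℝ) • a x - b x)
        - normSq Ω b - normSq Ω (fun x => (2 : ℝ) • b x - c x))
      ≤ 2 * dt * ∫ x in Ω, inner ℝ (bdf2 dt (a x) (b x) (c x)) (a x) := by
  have h := integral_inner_three_level ha hb hc
  have h0 := normSq_nonneg (Ω := Ω) (fun x => a x - (2 : ℝ) • b x + c x)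
  simp only [bdf2, inner_smul_left, integral_const_mul, h, RCLike.conj_to_real]
  rw [mul_inv_cancel_left₀ (by positivity)]
  linarith

/-- The `L²` pairing is continuous in its second argument. -/
theorem tendsto_integral_mul {f h : Pt m → ℝ} {k : ℕ → Pt m → ℝ} (hf : MemL2 Ω f)
    (hk : ∀ n, MemL2 Ω (k n)) (hh : MemL2 Ω h)
    (hlim : Tendsto (fun n => eLpNorm (fun x => k n x - h x) 2 (volume.restrict Ω)) atTop (𝓝 0)) :
    Tendsto (fun n => ∫ x in Ω, f x * k n x) atTop (𝓝 (∫ x in Ω, f x * h x)) := by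
  refine tendsto_integral_of_L1' _ (hf.integrable_mul hh).1
    (Eventually.of_forall fun n => hf.integrable_mul (hk n)) ?_
  have hb : Tendsto (fun n => eLpNorm f 2 (volume.restrict Ω)
      * eLpNorm (fun x => k n x - h x) 2 (volume.restrict Ω)) atTop (𝓝 0) := by
    simpa using ENNReal.Tendsto.const_mul hlim (Or.inr hf.2.ne)
  refine tendsto_of_tendsto_of_tendsto_of_le_of_le tendsto_const_nhds hb (fun _ => zero_le)
    fun n => ?_
  -- Hölder with exponents 2 and 2 gives convergence of the products in `L¹`.
  have := eLpNorm_smul_le_mul_eLpNorm (p := 2) (q := 2) (r := 1) ((hk n).sub hh).1 hf.1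
  refine le_trans (le_of_eq ?_) this
  congr 1 with x
  simp [mul_sub]

end SquareIntegrable

/-! ### Test functions and the fundamental lemma of the calculus of variations -/

section TestFunctions

variable {φ : Pt m → ℝ}

theorem IsTest.memL2 (hφ : IsTest Ω φ) : MemL2 Ω φ :=
  hφ.smooth.continuous.memLp_of_hasCompactSupport hφ.compact

theorem IsTest.partialDeriv (hφ : IsTest Ω φ) (i : Fin m) : IsTest Ω (partialDeriv i φ) where
  smooth := (hφ.smooth.fderiv_right (m := (⊤ : ℕ∞)) (by simp)).clm_apply contDiff_const
  compact := hφ.compact.fderiv_apply ℝ _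
  supp := (tsupport_fderiv_apply_subset ℝ _).trans hφ.supp

theorem IsTest.partialDeriv_comm (hφ : IsTest Ω φ) (i j : Fin m) :
    PCSAV.partialDeriv i (PCSAV.partialDeriv j φ)
      = PCSAV.partialDeriv j (PCSAV.partialDeriv i φ) := by
  have hd : Differentiable ℝ (fderiv ℝ φ) :=
    (hφ.smooth.fderiv_right (m := (⊤ : ℕ∞)) (by simp)).differentiable (by simp)
  have key : ∀ (a b : Pt m) x, fderiv ℝ (fun y => fderiv ℝ φ y a) x b
      = fderiv ℝ (fderiv ℝ φ) x b a := fun a b x => by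
    rw [fderiv_clm_apply (hd x) (by fun_prop)]
    simp
  funext x
  have hs : IsSymmSndFDerivAt ℝ φ x :=
    hφ.smooth.contDiffAt.isSymmSndFDerivAt (by
      rw [minSmoothness_of_isRCLikeNormedField]
      exact WithTop.coe_le_coe.2 (le_top : (2 : ℕ∞) ≤ ⊤))
  exact (key _ _ x).trans ((hs _ _).trans (key _ _ x).symm)

/-- Composition with a smooth function vanishing at `0`. -/
theorem IsTest.comp (hφ : IsTest Ω φ) {F : ℝ → ℝ} (hF : ContDiff ℝ (⊤ : ℕ∞) F) (h0 : F 0 = 0) :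
    IsTest Ω (fun x => F (φ x)) where
  smooth := hF.comp hφ.smooth
  compact := hφ.compact.comp_left h0
  supp := (tsupport_comp_subset h0 φ).trans hφ.supp

theorem IsTest.partialDeriv_comp (hφ : IsTest Ω φ) {F F' : ℝ → ℝ}
    (hF : ∀ t, HasDerivAt F (F' t) t) (i : Fin m) (x : Pt m) :
    PCSAV.partialDeriv i (fun x => F (φ x)) x = F' (φ x) * PCSAV.partialDeriv i φ x := by
  have h := (hF (φ x)).comp_hasFDerivAt x
    ((hφ.smooth.differentiable (by simp)) x).hasFDerivAt
  simp only [PCSAV.partialDeriv]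
  rw [show (fun x => F (φ x)) = F ∘ φ from rfl, h.fderiv]
  simp

/-- Square integrable functions that agree against all test functions agree almost everywhere. -/
theorem ae_eq_of_integral_test_eq (hΩ : IsOpen Ω) {f g : Pt m → ℝ} (hf : MemL2 Ω f)
    (hg : MemL2 Ω g) (h : ∀ φ, IsTest Ω φ → ∫ x in Ω, f x * φ x = ∫ x in Ω, g x * φ x) :
    f =ᵐ[volume.restrict Ω] g := by
  have hloc : LocallyIntegrableOn (fun x => f x - g x) Ω (volume.restrict Ω) :=
    ((hf.sub hg).locallyIntegrable one_le_two).locallyIntegrableOn _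
  have := hΩ.ae_eq_zero_of_integral_contDiff_smul_eq_zero hloc fun φ h1 h2 h3 => by
    have hφ : IsTest Ω φ := ⟨h1, h2, h3⟩
    have := h φ hφ
    rw [← sub_eq_zero, ← integral_sub (hf.integrable_mul hφ.memL2)
      (hg.integrable_mul hφ.memL2)] at this
    rw [← this]
    congr 1 with x
    simp only [smul_eq_mul]
    ring
  filter_upwards [this, ae_restrict_mem hΩ.measurableSet] with x hx hxΩ
  exact sub_eq_zero.1 (hx hxΩ)

end TestFunctions

/-! ### Weak derivatives, divergence and integration by parts on `H₀¹` -/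

section WeakDerivatives

variable {f g : Pt m → ℝ} {v w : Pt m → Pt m}

theorem weakPartial_spec {i : Fin m} (h : ∃ g, MemL2 Ω g ∧ HasWeakPartial Ω i f g) :
    MemL2 Ω (weakPartial Ω i f) ∧ HasWeakPartial Ω i f (weakPartial Ω i f) := by
  rw [weakPartial, dif_pos h]
  exact h.choose_spec

theorem MemH1.memL2_weakPartial (hf : MemH1 Ω f) (i : Fin m) : MemL2 Ω (weakPartial Ω i f) :=
  (weakPartial_spec (hf.2 i)).1

theorem MemH1.hasWeakPartial (hf : MemH1 Ω f) (i : Fin m) :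
    HasWeakPartial Ω i f (weakPartial Ω i f) :=
  (weakPartial_spec (hf.2 i)).2

/-- Uniqueness of weak derivatives: any explicit candidate identifies the chosen representative,
which is how linearity is transferred to it. -/
theorem HasWeakPartial.weakPartial_ae_eq (hΩ : IsOpen Ω) {i : Fin m} (hg : MemL2 Ω g)
    (h : HasWeakPartial Ω i f g) : weakPartial Ω i f =ᵐ[volume.restrict Ω] g := by
  have hs := weakPartial_spec ⟨g, hg, h⟩
  refine ae_eq_of_integral_test_eq hΩ hs.1 hg fun φ hφ => ?_
  have h1 := hs.2 φ hφ
  rw [h φ hφ] at h1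
  exact (neg_injective h1).symm

theorem HasWeakPartial.lincomb {i : Fin m} {f₁ f₂ g₁ g₂ : Pt m → ℝ} (hf₁ : MemL2 Ω f₁)
    (hf₂ : MemL2 Ω f₂) (hg₁ : MemL2 Ω g₁) (hg₂ : MemL2 Ω g₂) (h₁ : HasWeakPartial Ω i f₁ g₁)
    (h₂ : HasWeakPartial Ω i f₂ g₂) (a b : ℝ) :
    HasWeakPartial Ω i (fun x => a * f₁ x + b * f₂ x) (fun x => a * g₁ x + b * g₂ x) := by
  intro φ hφ
  have hφ' := (hφ.partialDeriv i).memL2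
  simp only [add_mul]
  rw [integral_add ((hf₁.mul_left a).integrable_mul hφ') ((hf₂.mul_left b).integrable_mul hφ'),
    integral_add ((hg₁.mul_left a).integrable_mul hφ.memL2)
      ((hg₂.mul_left b).integrable_mul hφ.memL2)]
  simp only [mul_assoc, integral_const_mul, h₁ φ hφ, h₂ φ hφ]
  ring

theorem MemH1.lincomb (hf : MemH1 Ω f) (hg : MemH1 Ω g) (a b : ℝ) :
    MemH1 Ω (fun x => a * f x + b * g x) :=
  ⟨(hf.1.mul_left a).add (hg.1.mul_left b), fun i =>
    ⟨_, ((hf.memL2_weakPartial i).mul_left a).add ((hg.memL2_weakPartial i).mul_left b),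
      (hf.hasWeakPartial i).lincomb hf.1 hg.1 (hf.memL2_weakPartial i) (hg.memL2_weakPartial i)
        (hg.hasWeakPartial i) a b⟩⟩

theorem MemH1.weakPartial_lincomb (hΩ : IsOpen Ω) (hf : MemH1 Ω f) (hg : MemH1 Ω g) (a b : ℝ)
    (i : Fin m) : weakPartial Ω i (fun x => a * f x + b * g x) =ᵐ[volume.restrict Ω]
      fun x => a * weakPartial Ω i f x + b * weakPartial Ω i g x :=
  ((hf.hasWeakPartial i).lincomb hf.1 hg.1 (hf.memL2_weakPartial i) (hg.memL2_weakPartial i)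
    (hg.hasWeakPartial i) a b).weakPartial_ae_eq hΩ
    (((hf.memL2_weakPartial i).mul_left a).add ((hg.memL2_weakPartial i).mul_left b))

theorem memH1_zero : MemH1 Ω (fun _ => (0 : ℝ)) :=
  ⟨MemLp.zero', fun _ => ⟨fun _ => 0, MemLp.zero', fun φ _ => by simp⟩⟩

theorem weakPartial_zero (hΩ : IsOpen Ω) (i : Fin m) :
    weakPartial Ω i (fun _ => (0 : ℝ)) =ᵐ[volume.restrict Ω] fun _ => 0 :=
  HasWeakPartial.weakPartial_ae_eq hΩ MemLp.zero' fun φ _ => by simp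

theorem memH10_zero (hΩ : IsOpen Ω) : MemH10 Ω (fun _ => (0 : ℝ)) := by
  refine ⟨memH1_zero, fun _ _ => 0, fun _ => ⟨contDiff_const, HasCompactSupport.zero, ?_⟩, ?_, ?_⟩
  · simp [tsupport]
  · simp
  · intro i
    have h0 : partialDeriv i (fun _ : Pt m => (0 : ℝ)) = fun _ => 0 := by
      funext x; simp [partialDeriv]
    have : eLpNorm (fun x => partialDeriv i (fun _ : Pt m => (0 : ℝ)) x
        - weakPartial Ω i (fun _ => 0) x) 2 (volume.restrict Ω) = 0 := by
      rw [eLpNorm_congr_ae (g := fun _ => (0 : ℝ))]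
      · simp
      · filter_upwards [weakPartial_zero hΩ i] with x hx
        simp [h0, hx]
    simp [this]

theorem weakDiv_spec (h : ∃ g, MemL2 Ω g ∧ HasWeakDiv Ω v g) :
    MemL2 Ω (weakDiv Ω v) ∧ HasWeakDiv Ω v (weakDiv Ω v) := by
  rw [weakDiv, dif_pos h]
  exact h.choose_spec

theorem HasWeakDiv.weakDiv_ae_eq (hΩ : IsOpen Ω) (hg : MemL2 Ω g)
    (h : HasWeakDiv Ω v g) : weakDiv Ω v =ᵐ[volume.restrict Ω] g := by
  have hs := weakDiv_spec ⟨g, hg, h⟩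
  refine ae_eq_of_integral_test_eq hΩ hs.1 hg fun φ hφ => ?_
  have h1 := hs.2 φ hφ
  rw [h φ hφ] at h1
  exact (neg_injective h1).symm

theorem VecH1.memL2 (hv : VecH1 Ω v) : MemL2 Ω v := memL2_of_comp fun i => (hv i).1

theorem VecH10.vecH1 (hv : VecH10 Ω v) : VecH1 Ω v := fun i => (hv i).1

theorem VecH1.memL2_jac (hv : VecH1 Ω v) (i j : Fin m) : MemL2 Ω (jac Ω v i j) :=
  (hv i).memL2_weakPartial j

theorem VecH1.hasWeakDiv (hv : VecH1 Ω v) : HasWeakDiv Ω v (fun x => ∑ i, jac Ω v i i x) := by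
  intro φ hφ
  simp only [Finset.sum_mul]
  rw [integral_finsetSum _ fun i _ => (hv i).1.integrable_mul (hφ.partialDeriv i).memL2,
    integral_finsetSum _ fun i _ => (hv.memL2_jac i i).integrable_mul hφ.memL2,
    ← Finset.sum_neg_distrib]
  exact Finset.sum_congr rfl fun i _ => (hv i).hasWeakPartial i φ hφ

theorem VecH1.weakDiv_ae_eq (hΩ : IsOpen Ω) (hv : VecH1 Ω v) :
    weakDiv Ω v =ᵐ[volume.restrict Ω] fun x => ∑ i, jac Ω v i i x :=
  hv.hasWeakDiv.weakDiv_ae_eq hΩ (MemL2.sum _ fun i _ => hv.memL2_jac i i)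

theorem VecH1.memL2_weakDiv (hv : VecH1 Ω v) : MemL2 Ω (weakDiv Ω v) :=
  (weakDiv_spec ⟨_, MemL2.sum _ fun i _ => hv.memL2_jac i i, hv.hasWeakDiv⟩).1

theorem Incompressible.memL2 (hv : Incompressible Ω v) : MemL2 Ω v := hv.1.1

/-- The Helmholtz orthogonality behind the projection step: the normal trace condition removes the
boundary term for every `H¹` function. -/
theorem Incompressible.integral_grad (hv : Incompressible Ω v) (hf : MemH1 Ω f) :
    ∫ x in Ω, ∑ i, v x i * weakPartial Ω i f x = 0 := by
  have h := hv.2.2 f hf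
  have h0 : ∫ x in Ω, weakDiv Ω v x * f x = 0 :=
    integral_eq_zero_of_ae <| hv.2.1.mono fun x hx => by simp [hx]
  linarith

theorem Incompressible.hasWeakDiv_zero (hv : Incompressible Ω v) :
    HasWeakDiv Ω v (fun _ => 0) := by
  intro φ hφ
  rw [(weakDiv_spec hv.1.2).2 φ hφ]
  congr 1
  exact integral_congr_ae <| hv.2.1.mono fun x hx => by simp [hx]

theorem HasWeakDiv.two_smul_sub {v₁ v₂ : Pt m → Pt m} (h₁ : MemL2 Ω v₁) (h₂ : MemL2 Ω v₂)
    (hd₁ : HasWeakDiv Ω v₁ fun _ => 0) (hd₂ : HasWeakDiv Ω v₂ fun _ => 0) :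
    HasWeakDiv Ω ((2 : ℝ) • v₁ - v₂) (fun _ => 0) := by
  intro φ hφ
  have hi : ∀ {v : Pt m → Pt m}, MemL2 Ω v →
      Integrable (fun x => ∑ i, v x i * partialDeriv i φ x) (volume.restrict Ω) := fun hv =>
    integrable_finsetSum _ fun i _ => (hv.comp i).integrable_mul (hφ.partialDeriv i).memL2
  have e1 := hd₁ φ hφ
  have e2 := hd₂ φ hφ
  have : ∫ x in Ω, ∑ i, ((2 : ℝ) • v₁ - v₂) x i * partialDeriv i φ x
      = 2 * (∫ x in Ω, ∑ i, v₁ x i * partialDeriv i φ x)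
        - ∫ x in Ω, ∑ i, v₂ x i * partialDeriv i φ x := by
    rw [← integral_const_mul, ← integral_sub ((hi h₁).const_mul 2) (hi h₂)]
    congr 1 with x
    rw [Finset.mul_sum, ← Finset.sum_sub_distrib]
    refine Finset.sum_congr rfl fun i _ => ?_
    simp only [Pi.sub_apply, Pi.smul_apply, PiLp.sub_apply, PiLp.smul_apply, smul_eq_mul]
    ring
  rw [this, e1, e2]
  simp

/-- Integration by parts between `H¹` and `H₀¹`. -/
theorem MemH1.integral_mul_weakPartial (hf : MemH1 Ω f) (hg : MemH10 Ω g) (i : Fin m) :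
    ∫ x in Ω, f x * weakPartial Ω i g x = -∫ x in Ω, weakPartial Ω i f x * g x := by
  obtain ⟨hg1, φ, hφ, hlim, hlim'⟩ := hg
  have h1 := tendsto_integral_mul hf.1 (fun n => ((hφ n).partialDeriv i).memL2)
    (hg1.memL2_weakPartial i) (hlim' i)
  have h2 := (tendsto_integral_mul (hf.memL2_weakPartial i) (fun n => (hφ n).memL2) hg1.1
    hlim).neg
  exact tendsto_nhds_unique h1 (h2.congr fun n => ((hf.hasWeakPartial i) _ (hφ n)).symm)

/-- Mixed partial derivatives may be exchanged in the `L²` pairing. -/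
theorem MemH1.integral_weakPartial_comm (hf : MemH1 Ω f) (hg : MemH10 Ω g) (i j : Fin m) :
    ∫ x in Ω, weakPartial Ω i f x * weakPartial Ω j g x
      = ∫ x in Ω, weakPartial Ω j f x * weakPartial Ω i g x := by
  obtain ⟨hg1, φ, hφ, -, hlim⟩ := hg
  have h1 := tendsto_integral_mul (hf.memL2_weakPartial i)
    (fun n => ((hφ n).partialDeriv j).memL2) (hg1.memL2_weakPartial j) (hlim j)
  have h2 := tendsto_integral_mul (hf.memL2_weakPartial j)
    (fun n => ((hφ n).partialDeriv i).memL2) (hg1.memL2_weakPartial i) (hlim i)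
  refine tendsto_nhds_unique h1 (h2.congr fun n => ?_)
  have e1 := hf.hasWeakPartial j _ ((hφ n).partialDeriv i)
  have e2 := hf.hasWeakPartial i _ ((hφ n).partialDeriv j)
  -- Both derivatives are moved onto the smooth approximant, where they commute.
  rw [(hφ n).partialDeriv_comm j i, e2] at e1
  exact (neg_injective e1).symm

end WeakDerivatives

end PCSAV

namespace PCSAV

variable {m : ℕ} {Ω : Set (Pt m)}

/-! ### Skew-symmetry of transport by a divergence-free `L²` field -/

section Transport

variable {f : Pt m → ℝ} {a : Pt m → Pt m}

/-- The integrand is `a·∇(F ∘ f)`. For a test function `φ` in place of `f`, `F ∘ φ` is again a test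
function and the integral vanishes by the definition of the weak divergence. Boundedness of `F'`
allows the passage to the limit. -/
theorem integral_transport_comp_eq_zero (ha : MemL2 Ω a) (hd : HasWeakDiv Ω a fun _ => 0)
    (hf : MemH10 Ω f) {F F' : ℝ → ℝ} (hF : ContDiff ℝ (⊤ : ℕ∞) F) (h0 : F 0 = 0)
    (hF' : ∀ t, HasDerivAt F (F' t) t) (hc : Continuous F') {M : ℝ} (hM : ∀ t, |F' t| ≤ M) :
    ∫ x in Ω, F' (f x) * ∑ j, a x j * weakPartial Ω j f x = 0 := by
  obtain ⟨hf1, φ, hφ, hlim, hlim'⟩ := hf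
  -- A subsequence converging almost everywhere gives pointwise convergence of `F'(φ)`, as dominated
  -- convergence requires.
  obtain ⟨ns, hns, hae⟩ := (tendstoInMeasure_of_tendsto_eLpNorm two_ne_zero
    (fun n => (hφ n).memL2.1) hf1.1.1 hlim).exists_seq_tendsto_ae
  have hmeas : ∀ n, AEStronglyMeasurable (fun x => F' (φ (ns n) x)) (volume.restrict Ω) :=
    fun n => hc.comp_aestronglyMeasurable (hφ _).memL2.1
  have hbd : ∀ {g : Pt m → ℝ}, MemL2 Ω g → ∀ n, MemL2 Ω (fun x => F' (φ (ns n) x) * g x) :=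
    fun hg n => MemLp.of_le_mul (c := M) hg ((hmeas n).mul hg.1) <| ae_of_all _ fun x => by
      rw [norm_mul]
      exact mul_le_mul_of_nonneg_right (hM _) (norm_nonneg _)
  have hbdf : ∀ {g : Pt m → ℝ}, MemL2 Ω g → MemL2 Ω (fun x => F' (f x) * g x) :=
    fun hg => MemLp.of_le_mul (c := M) hg
      ((hc.comp_aestronglyMeasurable hf1.1.1).mul hg.1) <| ae_of_all _ fun x => by
      rw [norm_mul]
      exact mul_le_mul_of_nonneg_right (hM _) (norm_nonneg _)
  have hcomp : ∀ j, Tendsto (fun n => ∫ x in Ω, a x j * (F' (φ (ns n) x)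
      * partialDeriv j (φ (ns n)) x)) atTop
      (𝓝 (∫ x in Ω, a x j * (F' (f x) * weakPartial Ω j f x))) := by
    intro j
    have hp := fun n => ((hφ (ns n)).partialDeriv j).memL2
    have hw := hf1.memL2_weakPartial j
    -- The limit is split as `F'(φ)(∂φ - ∂f) + F'(φ)∂f`: the first part is small in `L²`, the second
    -- is dominated by `M|aⱼ ∂ⱼf|`.
    have t1 : Tendsto (fun n => ∫ x in Ω, a x j * (F' (φ (ns n) x)
        * (partialDeriv j (φ (ns n)) x - weakPartial Ω j f x))) atTop
        (𝓝 (∫ x in Ω, a x j * (fun _ => (0 : ℝ)) x)) := by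
      refine tendsto_integral_mul (ha.comp j) (fun n => hbd ((hp n).sub hw) n) MemLp.zero' ?_
      have hb : Tendsto (fun n => ENNReal.ofReal M * eLpNorm
          (fun x => partialDeriv j (φ (ns n)) x - weakPartial Ω j f x) 2 (volume.restrict Ω))
          atTop (𝓝 0) := by
        simpa using ENNReal.Tendsto.const_mul ((hlim' j).comp hns.tendsto_atTop)
          (Or.inr ENNReal.ofReal_ne_top)
      refine tendsto_of_tendsto_of_tendsto_of_le_of_le tendsto_const_nhds hb (fun _ => zero_le)
        fun n => ?_
      refine eLpNorm_le_mul_eLpNorm_of_ae_le_mul (ae_of_all _ fun x => ?_) _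
      rw [sub_zero, norm_mul]
      exact mul_le_mul_of_nonneg_right (hM _) (norm_nonneg _)
    have t2 : Tendsto (fun n => ∫ x in Ω, a x j * (F' (φ (ns n) x) * weakPartial Ω j f x)) atTop
        (𝓝 (∫ x in Ω, a x j * (F' (f x) * weakPartial Ω j f x))) := by
      refine tendsto_integral_of_dominated_convergence
        (fun x => M * ‖a x j * weakPartial Ω j f x‖)
        (fun n => ((ha.comp j).integrable_mul (hbd hw n)).1)
        (((ha.comp j).integrable_mul hw).norm.const_mul M) (fun n => ae_of_all _ fun x => ?_) ?_
      · rw [mul_left_comm, norm_mul]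
        exact mul_le_mul_of_nonneg_right (hM _) (norm_nonneg _)
      · filter_upwards [hae] with x hx
        exact (((hc.tendsto _).comp hx).mul_const _).const_mul _
    have t3 := t1.add t2
    simp only [mul_zero, integral_zero, zero_add] at t3
    refine t3.congr fun n => ?_
    rw [← integral_add ((ha.comp j).integrable_mul (hbd ((hp n).sub hw) n))
      ((ha.comp j).integrable_mul (hbd hw n))]
    congr 1 with x
    ring
  have hsum := tendsto_finsetSum Finset.univ fun j _ => hcomp j
  have hz : ∀ n, ∑ j, ∫ x in Ω, a x j * (F' (φ (ns n) x) * partialDeriv j (φ (ns n)) x) = 0 := by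
    intro n
    have h := hd _ ((hφ (ns n)).comp hF h0)
    simp only [(hφ (ns n)).partialDeriv_comp hF', zero_mul, integral_zero, neg_zero] at h
    rwa [integral_finsetSum _ fun j _ => (ha.comp j).integrable_mul
      (hbd ((hφ (ns n)).partialDeriv j).memL2 n)] at h
  simp only [hz] at hsum
  rw [tendsto_nhds_unique tendsto_const_nhds hsum, ← integral_finsetSum _ fun j _ =>
    (ha.comp j).integrable_mul (hbdf (hf1.memL2_weakPartial j))]
  congr 1 with x
  rw [Finset.mul_sum]
  exact Finset.sum_congr rfl fun j _ => by ring

theorem mul_sin_div_eq (c t : ℝ) (hc : c ≠ 0) : c * Real.sin (t / c) = t * Real.sinc (t / c) := by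
  rcases eq_or_ne t 0 with rfl | ht
  · simp
  · rw [Real.sinc_of_ne_zero (div_ne_zero ht hc)]
    field_simp

/-- Transport by a weakly divergence-free square integrable field is skew-symmetric on `H₀¹`,
whenever the trilinear form is defined. -/
theorem integral_transport_mul_self_eq_zero (ha : MemL2 Ω a) (hd : HasWeakDiv Ω a fun _ => 0)
    (hf : MemH10 Ω f)
    (hi : IntegrableOn (fun x => (∑ j, a x j * weakPartial Ω j f x) * f x) Ω) :
    ∫ x in Ω, (∑ j, a x j * weakPartial Ω j f x) * f x = 0 := by
  have hc0 : ∀ n : ℕ, ((n : ℝ) + 1) ≠ 0 := fun n => by positivity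
  have hz : ∀ n : ℕ, ∫ x in Ω, (((n : ℝ) + 1) * Real.sin (f x / ((n : ℝ) + 1)))
      * ∑ j, a x j * weakPartial Ω j f x = 0 := by
    intro n
    have hc := hc0 n
    set c : ℝ := (n : ℝ) + 1
    -- The truncation `F'(t) = c sin(t/c)` is smooth, bounded by `|c|`, dominated by `|t|`, and
    -- tends to `t` as `c → ∞`.
    refine integral_transport_comp_eq_zero ha hd hf (M := |c|)
      (F := fun t => c ^ 2 * (1 - Real.cos (t / c))) (F' := fun t => c * Real.sin (t / c))
      ?_ (by simp) (fun t => ?_) (by fun_prop) fun t => ?_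
    · exact contDiff_const.mul (contDiff_const.sub (Real.contDiff_cos.comp
        (contDiff_id.div_const c)))
    · have h := (((Real.hasDerivAt_cos (t / c)).comp t
        ((hasDerivAt_id t).div_const c)).const_sub 1).const_mul (c ^ 2)
      refine h.congr_deriv ?_
      field_simp
    · rw [abs_mul]
      exact mul_le_of_le_one_right (abs_nonneg c) (Real.abs_sin_le_one (t / c))
  have hm := hf.1.1.1
  have hD : AEStronglyMeasurable (fun x => ∑ j, a x j * weakPartial Ω j f x)
      (volume.restrict Ω) := (integrable_finsetSum _ fun j _ =>
    (ha.comp j).integrable_mul (hf.1.memL2_weakPartial j)).1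
  have hlim : Tendsto (fun n : ℕ => ∫ x in Ω, (((n : ℝ) + 1) * Real.sin (f x / ((n : ℝ) + 1)))
      * ∑ j, a x j * weakPartial Ω j f x) atTop
      (𝓝 (∫ x in Ω, (∑ j, a x j * weakPartial Ω j f x) * f x)) := by
    -- Since `c sin(t/c) = t sinc(t/c)` and `|sinc| ≤ 1`, the trilinear integrand itself is the
    -- dominating function.
    refine tendsto_integral_of_dominated_convergence _ (fun n => ?_) hi.norm
      (fun n => ae_of_all _ fun x => ?_) (ae_of_all _ fun x => ?_)
    · exact AEStronglyMeasurable.mul ((by fun_prop : Continuous fun t : ℝ =>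
        ((n : ℝ) + 1) * Real.sin (t / ((n : ℝ) + 1))).comp_aestronglyMeasurable hm) hD
    · rw [mul_comm, norm_mul (Finset.sum _ _), norm_mul (Finset.sum _ _)]
      refine mul_le_mul_of_nonneg_left ?_ (norm_nonneg (Finset.sum _ _))
      rw [mul_sin_div_eq _ _ (hc0 n), norm_mul (f x)]
      exact mul_le_of_le_one_right (norm_nonneg (f x)) (Real.abs_sinc_le_one _)
    · rw [mul_comm (Finset.sum _ _)]
      refine Tendsto.mul_const _ ?_
      simp only [fun n : ℕ => mul_sin_div_eq _ (f x) (hc0 n)]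
      have h1 : Tendsto (fun n : ℕ => f x / ((n : ℝ) + 1)) atTop (𝓝 0) :=
        tendsto_const_nhds.div_atTop
          (tendsto_atTop_add_const_right _ _ tendsto_natCast_atTop_atTop)
      simpa using ((Real.continuous_sinc.tendsto 0).comp h1).const_mul (f x)
  simp only [hz] at hlim
  exact (tendsto_nhds_unique tendsto_const_nhds hlim).symm

end Transport

/-! ### The div-curl identity on `H₀¹` -/

section Curl

theorem sum_sum_Ioi_of_symm {c : Fin m → Fin m → ℝ} (hs : ∀ i j, c i j = c j i)
    (h0 : ∀ i, c i i = 0) : ∑ i, ∑ j, c i j = 2 * ∑ i, ∑ j ∈ Finset.Ioi i, c i j := by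
  have hI : ∀ i, ∑ j ∈ Finset.Ioi i, c i j = ∑ j, if i < j then c i j else 0 := fun i => by
    rw [← Finset.sum_filter, Finset.filter_lt_eq_Ioi]
  have hsw : ∑ i, ∑ j, (if i < j then c i j else 0) = ∑ i, ∑ j, if j < i then c i j else 0 := by
    rw [Finset.sum_comm]
    simp only [fun i j => hs i j]
  simp only [hI]
  rw [two_mul]
  nth_rewrite 2 [hsw]
  simp only [← Finset.sum_add_distrib]
  refine Finset.sum_congr rfl fun i _ => Finset.sum_congr rfl fun j _ => ?_
  rcases lt_trichotomy i j with h | rfl | h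
  · simp [h, h.not_gt]
  · simp [h0]
  · simp [h, h.not_gt]

/-- `‖∇v‖² = ‖∇·v‖² + ‖∇×v‖²` on `H₀¹`. -/
theorem VecH10.jacNormSq_eq (hΩ : IsOpen Ω) {v : Pt m → Pt m} (hv : VecH10 Ω v) :
    jacNormSq Ω v = normSq Ω (weakDiv Ω v) + curlNormSq Ω v := by
  have hJ := hv.vecH1.memL2_jac
  have hdiv : normSq Ω (weakDiv Ω v) = ∑ i, ∑ j, ∫ x in Ω, jac Ω v i j x * jac Ω v j i x := by
    rw [normSq_congr (hv.vecH1.weakDiv_ae_eq hΩ), normSq_eq_integral_mul]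
    simp only [Finset.sum_mul_sum]
    rw [integral_finsetSum _ fun i _ => integrable_finsetSum _ fun j _ =>
      (hJ i i).integrable_mul (hJ j j)]
    refine Finset.sum_congr rfl fun i _ => ?_
    rw [integral_finsetSum _ fun j _ => (hJ i i).integrable_mul (hJ j j)]
    -- Exchanging derivatives turns `∂ᵢvᵢ ∂ⱼvⱼ` into `∂ⱼvᵢ ∂ᵢvⱼ`, the cross term in the expansion of
    -- the squared curl.
    exact Finset.sum_congr rfl fun j _ => (hv i).1.integral_weakPartial_comm (hv j) i j
  have hc : ∀ i j, normSq Ω (fun x => jac Ω v j i x - jac Ω v i j x)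
      = normSq Ω (jac Ω v j i) + normSq Ω (jac Ω v i j)
        - 2 * ∫ x in Ω, jac Ω v i j x * jac Ω v j i x := by
    intro i j
    have h1 := (hJ j i).integrable_mul (hJ j i)
    have h2 := (hJ i j).integrable_mul (hJ i j)
    have h12 : Integrable (fun x => jac Ω v j i x * jac Ω v j i x + jac Ω v i j x * jac Ω v i j x)
      (volume.restrict Ω) := h1.add h2
    simp only [normSq_eq_integral_mul]
    rw [← integral_const_mul, ← integral_add h1 h2,
      ← integral_sub h12 (((hJ i j).integrable_mul (hJ j i)).const_mul 2)]
    congr 1 with x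
    ring
  have hcurl : 2 * curlNormSq Ω v
      = ∑ i, ∑ j, normSq Ω (fun x => jac Ω v j i x - jac Ω v i j x) := by
    refine (sum_sum_Ioi_of_symm (fun i j => ?_) fun i => ?_).symm
    · simp only [normSq, norm_sub_rev]
    · simp [normSq]
  simp only [hc, Finset.sum_sub_distrib, Finset.sum_add_distrib, ← Finset.mul_sum] at hcurl
  rw [Finset.sum_comm (f := fun i j => normSq Ω (jac Ω v j i)), ← hdiv] at hcurl
  simp only [jacNormSq]
  linarith

end Curl

/-! ### Weak gradients as vector fields -/

section Gradient

variable {f g : Pt m → ℝ} {v : Pt m → Pt m}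

/-- The weak gradient. -/
noncomputable def weakGrad (Ω : Set (Pt m)) (f : Pt m → ℝ) (x : Pt m) : Pt m :=
  WithLp.toLp 2 fun i => weakPartial Ω i f x

theorem MemH1.memL2_weakGrad (hf : MemH1 Ω f) : MemL2 Ω (weakGrad Ω f) :=
  memL2_of_comp hf.memL2_weakPartial

theorem MemH1.gradNormSq_eq (hf : MemH1 Ω f) : gradNormSq Ω f = normSq Ω (weakGrad Ω f) := by
  simp only [gradNormSq, normSq]
  rw [← integral_finsetSum _ fun i _ => (hf.memL2_weakPartial i).integrable_norm_sq]
  simp [weakGrad, EuclideanSpace.norm_sq_eq]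

theorem inner_weakGrad (y x : Pt m) :
    inner ℝ y (weakGrad Ω f x) = ∑ i, y i * weakPartial Ω i f x := by
  simp [weakGrad, PiLp.inner_apply, mul_comm]

theorem Incompressible.integral_inner_weakGrad (hv : Incompressible Ω v) (hf : MemH1 Ω f) :
    ∫ x in Ω, inner ℝ (v x) (weakGrad Ω f x) = 0 := by
  simpa only [inner_weakGrad] using hv.integral_grad hf

theorem MemH1.integral_mul_weakDiv (hΩ : IsOpen Ω) (hf : MemH1 Ω f) (hv : VecH10 Ω v) :
    ∫ x in Ω, f x * weakDiv Ω v x = -∫ x in Ω, inner ℝ (v x) (weakGrad Ω f x) := by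
  have h1 : ∫ x in Ω, f x * weakDiv Ω v x = ∫ x in Ω, ∑ i, f x * jac Ω v i i x :=
    integral_congr_ae <| (hv.vecH1.weakDiv_ae_eq hΩ).mono fun x hx => by
      simp only [hx, Finset.mul_sum]
  simp only [inner_weakGrad]
  rw [h1, integral_finsetSum _ fun i _ => hf.1.integrable_mul (hv.vecH1.memL2_jac i i),
    integral_finsetSum _ fun i _ => (hv i).1.1.integrable_mul (hf.memL2_weakPartial i),
    ← Finset.sum_neg_distrib]
  refine Finset.sum_congr rfl fun i _ => ?_
  simp only [jac, hf.integral_mul_weakPartial (hv i) i, mul_comm]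

end Gradient

end PCSAV

namespace PCSAV

variable {m : ℕ} {Ω : Set (Pt m)} {P : Params} {X : Iterates m} {n : ℕ}

theorem Params.dt_pos (hT : 0 < P.T) (hN : 0 < P.N) : 0 < P.dt :=
  div_pos hT (Nat.cast_pos.2 hN)

/-! ### Pressure work through the auxiliary variables `H` and `g` -/

section Pressure

theorem hSeq_sub (n : ℕ) (x : Pt m) :
    hSeq Ω P.ν X.ustar X.p (n + 1) x - hSeq Ω P.ν X.ustar X.p n x
      = X.p (n + 1) x - X.p n x + P.ν * weakDiv Ω (X.ustar (n + 1)) x := by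
  simp only [hSeq, gSeq]
  ring

/-- The increment of `H` is the projection potential, which lies in `H¹`; regularity therefore
propagates from level 1, although `p` and `g` separately are only known to be in `L²`. -/
theorem IsSolution.memH1_hSeq (hX : IsSolution Ω P X) {n : ℕ} (h1 : 1 ≤ n) :
    n ≤ P.N → MemH1 Ω (hSeq Ω P.ν X.ustar X.p n) := by
  induction n, h1 using Nat.le_induction with
  | base => exact fun _ => hX.h_start
  | succ n h1 ih =>
    intro hn
    have h := (ih (by omega)).lincomb (hX.projection n h1 hn).1 1 1
    convert h using 2 with x
    rw [one_mul, one_mul, ← hSeq_sub]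
    ring

theorem IsSolution.memL2_gSeq (hX : IsSolution Ω P X) (n : ℕ) :
    n ≤ P.N → MemL2 Ω (gSeq Ω P.ν X.ustar n) := by
  induction n with
  | zero => exact fun _ => MemLp.zero
  | succ n ih =>
    exact fun hn => ((hX.ustar_mem (n + 1) (by omega) hn).vecH1.memL2_weakDiv.mul_left P.ν).add
      (ih (by omega))

/-- The work of the pressure in terms of the auxiliary variables `H` and `g`. -/
theorem IsSolution.integral_pressure (hΩ : IsOpen Ω) (hX : IsSolution Ω P X) (hν : 0 < P.ν)
    (h1 : 1 ≤ n) (hn : n + 1 ≤ P.N) :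
    2 * P.dt * ∫ x in Ω, X.p n x * weakDiv Ω (X.ustar (n + 1)) x
      = -(2 * P.dt) * (∫ x in Ω, inner ℝ (X.ustar (n + 1) x)
          (weakGrad Ω (hSeq Ω P.ν X.ustar X.p n) x))
        - (P.ν⁻¹ * P.dt * (normSq Ω (gSeq Ω P.ν X.ustar (n + 1))
          - normSq Ω (gSeq Ω P.ν X.ustar n))
          - P.ν * P.dt * normSq Ω (weakDiv Ω (X.ustar (n + 1)))) := by
  have hU := hX.ustar_mem (n + 1) (by omega) hn
  have hH := hX.memH1_hSeq h1 (by omega)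
  have hg := hX.memL2_gSeq n (by omega)
  have hg1 := hX.memL2_gSeq (n + 1) hn
  have hD := hU.vecH1.memL2_weakDiv
  have hsplit : ∫ x in Ω, X.p n x * weakDiv Ω (X.ustar (n + 1)) x
      = (∫ x in Ω, hSeq Ω P.ν X.ustar X.p n x * weakDiv Ω (X.ustar (n + 1)) x)
        - ∫ x in Ω, gSeq Ω P.ν X.ustar n x * weakDiv Ω (X.ustar (n + 1)) x := by
    rw [← integral_sub (hH.1.integrable_mul hD) (hg.integrable_mul hD)]
    congr 1 with x
    simp only [hSeq]
    ring
  have hgg := two_mul_integral_inner_sub hg1 hg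
  have hdiff : ∀ x, gSeq Ω P.ν X.ustar (n + 1) x - gSeq Ω P.ν X.ustar n x
      = P.ν * weakDiv Ω (X.ustar (n + 1)) x := fun x => by simp only [gSeq]; ring
  have hsc : normSq Ω (fun x => P.ν * weakDiv Ω (X.ustar (n + 1)) x)
      = P.ν ^ 2 * normSq Ω (weakDiv Ω (X.ustar (n + 1))) := by
    simp only [normSq, norm_mul, mul_pow, integral_const_mul, Real.norm_eq_abs, sq_abs]
  have hin : ∫ x in Ω, inner ℝ (gSeq Ω P.ν X.ustar n x) (P.ν * weakDiv Ω (X.ustar (n + 1)) x)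
      = P.ν * ∫ x in Ω, gSeq Ω P.ν X.ustar n x * weakDiv Ω (X.ustar (n + 1)) x := by
    rw [← integral_const_mul]
    congr 1 with x
    simp only [RCLike.inner_apply, conj_trivial]
    ring
  simp only [hdiff, hsc, hin] at hgg
  rw [hsplit, hH.integral_mul_weakDiv hΩ hU]
  have hG : ∫ x in Ω, gSeq Ω P.ν X.ustar n x * weakDiv Ω (X.ustar (n + 1)) x
      = P.ν⁻¹ * ((normSq Ω (gSeq Ω P.ν X.ustar (n + 1)) - normSq Ω (gSeq Ω P.ν X.ustar n)
        - P.ν ^ 2 * normSq Ω (weakDiv Ω (X.ustar (n + 1)))) / 2) := by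
    rw [← hgg]
    field_simp
  rw [hG]
  field_simp

end Pressure

/-! ### Kinetic energy and convection -/

section Momentum

theorem IsSolution.ustar_ae_eq (hX : IsSolution Ω P X) (hdt : 0 < P.dt) (h1 : 1 ≤ n)
    (hn : n + 1 ≤ P.N) : X.ustar (n + 1) =ᵐ[volume.restrict Ω] fun x => X.u (n + 1) x
      + (2 * P.dt / 3) • weakGrad Ω (fun x => X.p (n + 1) x - X.p n x
        + P.ν * weakDiv Ω (X.ustar (n + 1)) x) x := by
  filter_upwards [ae_all_iff.2 (hX.projection n h1 hn).2] with x hx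
  ext i
  have := hx i
  simp only [PiLp.add_apply, PiLp.smul_apply, weakGrad, smul_eq_mul]
  field_simp at this ⊢
  linarith

theorem IsSolution.weakGrad_increment (hΩ : IsOpen Ω) (hX : IsSolution Ω P X) (h1 : 1 ≤ n)
    (hn : n + 1 ≤ P.N) :
    weakGrad Ω (fun x => X.p (n + 1) x - X.p n x + P.ν * weakDiv Ω (X.ustar (n + 1)) x)
      =ᵐ[volume.restrict Ω] fun x => weakGrad Ω (hSeq Ω P.ν X.ustar X.p (n + 1)) x
        - weakGrad Ω (hSeq Ω P.ν X.ustar X.p n) x := by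
  have e : (fun x => X.p (n + 1) x - X.p n x + P.ν * weakDiv Ω (X.ustar (n + 1)) x)
      = fun x => 1 * hSeq Ω P.ν X.ustar X.p (n + 1) x + -1 * hSeq Ω P.ν X.ustar X.p n x := by
    funext x
    rw [← hSeq_sub]
    ring
  have hl := fun i => (hX.memH1_hSeq (by omega) hn).weakPartial_lincomb hΩ
    (hX.memH1_hSeq h1 (by omega)) 1 (-1) i
  filter_upwards [ae_all_iff.2 hl] with x hx
  ext i
  rw [e]
  simp only [weakGrad, PiLp.sub_apply, hx i]
  ring

/-- The predicted velocity is tested against gradients. -/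
theorem IsSolution.integral_ustar_weakGrad (hX : IsSolution Ω P X) (hdt : 0 < P.dt) (h1 : 1 ≤ n)
    (hn : n + 1 ≤ P.N) {f : Pt m → ℝ} (hf : MemH1 Ω f) :
    ∫ x in Ω, inner ℝ (X.ustar (n + 1) x) (weakGrad Ω f x)
      = 2 * P.dt / 3 * ∫ x in Ω, inner ℝ (weakGrad Ω f x) (weakGrad Ω (fun x => X.p (n + 1) x
        - X.p n x + P.ν * weakDiv Ω (X.ustar (n + 1)) x) x) := by
  have hφ := (hX.projection n h1 hn).1
  have hu := hX.incompressible (n + 1) hn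
  have hae : (fun x => inner ℝ (X.ustar (n + 1) x) (weakGrad Ω f x)) =ᵐ[volume.restrict Ω]
      fun x => inner ℝ (X.u (n + 1) x) (weakGrad Ω f x)
        + 2 * P.dt / 3 * inner ℝ (weakGrad Ω (fun x => X.p (n + 1) x - X.p n x
          + P.ν * weakDiv Ω (X.ustar (n + 1)) x) x) (weakGrad Ω f x) :=
    (hX.ustar_ae_eq hdt h1 hn).mono fun x hx => by
      simp only [hx, inner_add_left, inner_smul_left, conj_trivial]
  rw [integral_congr_ae hae, integral_add (hu.memL2.integrable_inner hf.memL2_weakGrad)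
      ((hφ.memL2_weakGrad.integrable_inner hf.memL2_weakGrad).const_mul _),
    hu.integral_inner_weakGrad hf, zero_add, integral_const_mul]
  simp only [real_inner_comm]

/-- The discrete kinetic energy produced by the prediction and projection steps. -/
theorem IsSolution.kinetic_le (hX : IsSolution Ω P X) (hdt : 0 < P.dt) (h1 : 1 ≤ n)
    (hn : n + 1 ≤ P.N) :
    1 / 2 * (normSq Ω (X.u (n + 1)) + normSq Ω (extrap X.u (n + 1)) - normSq Ω (X.u n)
        - normSq Ω (extrap X.u n))
      + 4 * P.dt ^ 2 / 3 * normSq Ω (weakGrad Ω (fun x => X.p (n + 1) x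
        - X.p n x + P.ν * weakDiv Ω (X.ustar (n + 1)) x))
      ≤ 2 * P.dt * ∫ x in Ω, inner ℝ (bdf2 P.dt (X.ustar (n + 1) x) (X.u n x) (X.u (n - 1) x))
        (X.ustar (n + 1) x) := by
  have hφ := (hX.projection n h1 hn).1
  have hG := hX.integral_ustar_weakGrad hdt h1 hn hφ
  have hae := hX.ustar_ae_eq hdt h1 hn
  set G := weakGrad Ω (fun x => X.p (n + 1) x - X.p n x + P.ν * weakDiv Ω (X.ustar (n + 1)) x)
    with hGdef
  have hGm : MemL2 Ω G := hφ.memL2_weakGrad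
  have hu2 := hX.incompressible (n + 1) hn
  have hu1 := hX.incompressible n (by omega)
  have hu0 := hX.incompressible (n - 1) (by omega)
  have hUm := (hX.ustar_mem (n + 1) (by omega) hn).vecH1.memL2
  have hB : MemL2 Ω (fun x => bdf2 P.dt (X.u (n + 1) x) (X.u n x) (X.u (n - 1) x)) :=
    (((hu2.memL2.smul 3).sub (hu1.memL2.smul 4)).add hu0.memL2).smul _
  have hle := le_integral_inner_bdf2 hu2.memL2 hu1.memL2 hu0.memL2 hdt
  -- All three velocities are incompressible, hence orthogonal to the gradient `G`.
  have hBG : ∫ x in Ω, inner ℝ (bdf2 P.dt (X.u (n + 1) x) (X.u n x) (X.u (n - 1) x)) (G x) = 0 := by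
    have e : ∀ x, inner ℝ (bdf2 P.dt (X.u (n + 1) x) (X.u n x) (X.u (n - 1) x)) (G x)
        = (2 * P.dt)⁻¹ * (3 * inner ℝ (X.u (n + 1) x) (G x) - 4 * inner ℝ (X.u n x) (G x)
          + inner ℝ (X.u (n - 1) x) (G x)) := fun x => by
      simp only [bdf2, inner_smul_left, inner_add_left, inner_sub_left, conj_trivial]
    have i2 := (hu2.memL2.integrable_inner hGm).const_mul 3
    have i1 := (hu1.memL2.integrable_inner hGm).const_mul 4
    have i21 : Integrable (fun x => 3 * inner ℝ (X.u (n + 1) x) (G x)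
      - 4 * inner ℝ (X.u n x) (G x)) (volume.restrict Ω) := i2.sub i1
    simp only [e]
    rw [integral_const_mul, integral_add i21 (hu0.memL2.integrable_inner hGm),
      integral_sub i2 i1, integral_const_mul, integral_const_mul,
      hu2.integral_inner_weakGrad hφ, hu1.integral_inner_weakGrad hφ,
      hu0.integral_inner_weakGrad hφ]
    ring
  -- Replacing `u` by `u_*` in the quotient adds exactly `G`, because `3/(2Δt) · 2Δt/3 = 1`.
  have hsplit : ∫ x in Ω, inner ℝ (bdf2 P.dt (X.ustar (n + 1) x) (X.u n x) (X.u (n - 1) x))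
        (X.ustar (n + 1) x)
      = (∫ x in Ω, inner ℝ (bdf2 P.dt (X.u (n + 1) x) (X.u n x) (X.u (n - 1) x)) (X.u (n + 1) x))
        + 2 * P.dt / 3 * (∫ x in Ω,
          inner ℝ (bdf2 P.dt (X.u (n + 1) x) (X.u n x) (X.u (n - 1) x)) (G x))
        + ∫ x in Ω, inner ℝ (X.ustar (n + 1) x) (G x) := by
    have i1 := hB.integrable_inner hu2.memL2
    have i2 := (hB.integrable_inner hGm).const_mul (2 * P.dt / 3)
    have i12 : Integrable (fun x =>
      inner ℝ (bdf2 P.dt (X.u (n + 1) x) (X.u n x) (X.u (n - 1) x)) (X.u (n + 1) x)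
      + 2 * P.dt / 3 * inner ℝ (bdf2 P.dt (X.u (n + 1) x) (X.u n x) (X.u (n - 1) x)) (G x))
      (volume.restrict Ω) := i1.add i2
    rw [← integral_const_mul, ← integral_add i1 i2,
      ← integral_add i12 (hUm.integrable_inner hGm)]
    refine integral_congr_ae (hae.mono fun x hx => ?_)
    simp only [hx, bdf2, inner_smul_left, inner_smul_right, inner_add_left, inner_sub_left,
      inner_add_right, conj_trivial, real_inner_comm (G x) (X.u (n + 1) x)]
    field_simp
    ring
  have hGG : ∫ x in Ω, inner ℝ (G x) (G x) = normSq Ω G := by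
    simp only [normSq, real_inner_self_eq_norm_sq]
  rw [hsplit, hBG, hG, hGG]
  have hle' : 1 / 2 * (normSq Ω (X.u (n + 1)) + normSq Ω (extrap X.u (n + 1)) - normSq Ω (X.u n)
        - normSq Ω (extrap X.u n)) ≤ 2 * P.dt * ∫ x in Ω,
      inner ℝ (bdf2 P.dt (X.u (n + 1) x) (X.u n x) (X.u (n - 1) x)) (X.u (n + 1) x) := hle
  linarith

/-- The convective terms vanish when tested with the convected velocity. -/
theorem IsSolution.convection_eq_zero (hΩ : IsOpen Ω) (hX : IsSolution Ω P X) (h1 : 1 ≤ n)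
    (hn : n + 1 ≤ P.N) :
    ∫ x in Ω, inner ℝ (advect Ω (extrap X.u n) (X.ustar (n + 1)) x) (X.ustar (n + 1) x) = 0 ∧
    ∫ x in Ω, weakDiv Ω (extrap X.u n) x * inner ℝ (X.ustar (n + 1) x) (X.ustar (n + 1) x) = 0 := by
  have hu1 := hX.incompressible n (by omega)
  have hu0 := hX.incompressible (n - 1) (by omega)
  have hU := hX.ustar_mem (n + 1) (by omega) hn
  have ha : MemL2 Ω (extrap X.u n) := (hu1.memL2.smul 2).sub hu0.memL2
  have hd : HasWeakDiv Ω (extrap X.u n) fun _ => 0 :=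
    hu1.hasWeakDiv_zero.two_smul_sub hu1.memL2 hu0.memL2 hu0.hasWeakDiv_zero
  constructor
  · have hcomp : ∀ i, IntegrableOn (fun x => (∑ j, extrap X.u n x j
        * weakPartial Ω j (fun x => X.ustar (n + 1) x i) x) * X.ustar (n + 1) x i) Ω := by
      intro i
      -- The momentum equation grants integrability only of full inner products; a test field with
      -- one nonzero component isolates each summand.
      have hv : VecH10 Ω (fun x => EuclideanSpace.single i (X.ustar (n + 1) x i)) := by
        intro k
        rcases eq_or_ne k i with rfl | hk
        · simpa using hU k
        · simpa [hk] using memH10_zero hΩ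
      refine (hX.momentum n h1 hn _ hv).1.congr_fun (fun x _ => ?_) hΩ.measurableSet
      simp [advect, jac, EuclideanSpace.inner_single_right]
      ring
    simp only [PiLp.inner_apply, RCLike.inner_apply, conj_trivial, advect, jac]
    rw [integral_finsetSum _ fun i _ => (hcomp i).congr (ae_of_all _ fun x => mul_comm _ _)]
    refine Finset.sum_eq_zero fun i _ => ?_
    simp only [mul_comm (X.ustar (n + 1) _ i)]
    exact integral_transport_mul_self_eq_zero ha hd (hU i) (hcomp i)
  · exact integral_eq_zero_of_ae <| (hd.weakDiv_ae_eq hΩ MemLp.zero').mono fun x hx => by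
      simp [hx]

end Momentum

/-! ### Elastic and penalty energies -/

section Director

theorem MemH1.memH1_bdf2 {a b c : Pt m → ℝ} (ha : MemH1 Ω a) (hb : MemH1 Ω b) (hc : MemH1 Ω c)
    (dt : ℝ) : MemH1 Ω (fun x => bdf2 dt (a x) (b x) (c x)) := by
  -- Adding a zero multiple of the zero function makes the binary `lincomb` act as scaling.
  have h := (ha.lincomb (hb.lincomb hc (-4) 1) 3 1).lincomb memH1_zero (2 * dt)⁻¹ 0
  convert h using 2 with x
  simp only [bdf2, smul_eq_mul]
  ring

theorem MemH1.weakPartial_bdf2 (hΩ : IsOpen Ω) {a b c : Pt m → ℝ} (ha : MemH1 Ω a)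
    (hb : MemH1 Ω b) (hc : MemH1 Ω c) (dt : ℝ) (i : Fin m) :
    weakPartial Ω i (fun x => bdf2 dt (a x) (b x) (c x)) =ᵐ[volume.restrict Ω] fun x =>
      bdf2 dt (weakPartial Ω i a x) (weakPartial Ω i b x) (weakPartial Ω i c x) := by
  have e : (fun x => bdf2 dt (a x) (b x) (c x)) = fun x =>
      (2 * dt)⁻¹ * (3 * a x + 1 * (-4 * b x + 1 * c x)) + 0 * 0 := by
    funext x
    simp only [bdf2, smul_eq_mul]
    ring
  have hbc := hb.lincomb hc (-4) 1
  have habc := ha.lincomb hbc 3 1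
  rw [e]
  filter_upwards [habc.weakPartial_lincomb hΩ memH1_zero (2 * dt)⁻¹ 0 i,
    ha.weakPartial_lincomb hΩ hbc 3 1 i, hb.weakPartial_lincomb hΩ hc (-4) 1 i] with x h1 h2 h3
  rw [h1, h2, h3]
  simp only [bdf2, smul_eq_mul]
  ring

theorem MemH1.weakPartial_two_smul_sub (hΩ : IsOpen Ω) {a b : Pt m → ℝ} (ha : MemH1 Ω a)
    (hb : MemH1 Ω b) (i : Fin m) :
    weakPartial Ω i (fun x => 2 * a x - b x) =ᵐ[volume.restrict Ω] fun x =>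
      (2 : ℝ) • weakPartial Ω i a x - weakPartial Ω i b x := by
  have e : (fun x => 2 * a x - b x) = fun x => 2 * a x + -1 * b x := by
    funext x
    ring
  rw [e]
  filter_upwards [ha.weakPartial_lincomb hΩ hb 2 (-1) i] with x hx
  rw [hx, smul_eq_mul]
  ring

theorem jac_extrap_ae_eq (hΩ : IsOpen Ω) {d : ℕ → Pt m → Pt m} (h1 : VecH1 Ω (d n))
    (h0 : VecH1 Ω (d (n - 1))) (i j : Fin m) :
    jac Ω (extrap d n) i j =ᵐ[volume.restrict Ω] fun x =>
      (2 : ℝ) • jac Ω (d n) i j x - jac Ω (d (n - 1)) i j x :=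
  (h1 i).weakPartial_two_smul_sub hΩ (h0 i) j

/-- The discrete elastic energy estimate. -/
theorem le_sum_integral_jac_bdf2 (hΩ : IsOpen Ω) {d : ℕ → Pt m → Pt m} (h2 : VecH1 Ω (d (n + 1)))
    (h1 : VecH1 Ω (d n)) (h0 : VecH1 Ω (d (n - 1))) {dt : ℝ} (hdt : 0 < dt) :
    1 / 2 * (jacNormSq Ω (d (n + 1)) + jacNormSq Ω (extrap d (n + 1)) - jacNormSq Ω (d n)
        - jacNormSq Ω (extrap d n))
      ≤ 2 * dt * ∑ i, ∑ j, ∫ x in Ω, jac Ω (d (n + 1)) i j x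
        * jac Ω (fun x => bdf2 dt (d (n + 1) x) (d n x) (d (n - 1) x)) i j x := by
  have hij : ∀ i j, 1 / 2 * (normSq Ω (jac Ω (d (n + 1)) i j)
      + normSq Ω (jac Ω (extrap d (n + 1)) i j) - normSq Ω (jac Ω (d n) i j)
      - normSq Ω (jac Ω (extrap d n) i j)) ≤ 2 * dt * ∫ x in Ω, jac Ω (d (n + 1)) i j x
        * jac Ω (fun x => bdf2 dt (d (n + 1) x) (d n x) (d (n - 1) x)) i j x := by
    intro i j
    rw [normSq_congr (jac_extrap_ae_eq (n := n + 1) hΩ h2 h1 i j),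
      normSq_congr (jac_extrap_ae_eq hΩ h1 h0 i j)]
    refine (le_integral_inner_bdf2 (h2.memL2_jac i j) (h1.memL2_jac i j) (h0.memL2_jac i j)
      hdt).trans_eq ?_
    congr 1
    refine integral_congr_ae (((h2 i).weakPartial_bdf2 hΩ (h1 i) (h0 i) dt j).mono fun x hx => ?_)
    simp only [RCLike.inner_apply, conj_trivial]
    exact congrArg _ hx.symm
  simp only [jacNormSq, ← Finset.sum_add_distrib, ← Finset.sum_sub_distrib, Finset.mul_sum]
    at hij ⊢
  exact Finset.sum_le_sum fun i _ => Finset.sum_le_sum fun j _ => hij i j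

/-- Balance of the elastic energy and of the penalty energy. -/
theorem IsSolution.director_le (hΩ : IsOpen Ω) (hX : IsSolution Ω P X) (hdt : 0 < P.dt)
    (hε : 0 < P.ε) (h1 : 1 ≤ n) (hn : n + 1 ≤ P.N) :
    1 / 2 * (jacNormSq Ω (X.d (n + 1)) + jacNormSq Ω (extrap X.d (n + 1)) - jacNormSq Ω (X.d n)
        - jacNormSq Ω (extrap X.d n))
      + P.ε ^ 2 / 4 * (normSq Ω (X.q (n + 1)) + normSq Ω (extrap X.q (n + 1)) - normSq Ω (X.q n)
        - normSq Ω (extrap X.q n))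
      + 2 * P.dt * (savRatio P X.s (n + 1) * ∫ x in Ω,
        inner ℝ (advect Ω (extrap X.u n) (extrap X.d n) x) (X.w (n + 1) x))
      + 2 * P.dt * P.γ * normSq Ω (X.w (n + 1)) ≤ 0 := by
  have d2 := hX.d_mem (n + 1) hn
  have d1 := hX.d_mem n (by omega)
  have d0 := hX.d_mem (n - 1) (by omega)
  have q2 := hX.q_mem (n + 1) hn
  have q1 := hX.q_mem n (by omega)
  have q0 := hX.q_mem (n - 1) (by omega)
  have hw := hX.w_mem (n + 1) hn
  have hel := le_sum_integral_jac_bdf2 hΩ d2 d1 d0 hdt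
  have hq : 1 / 2 * (normSq Ω (X.q (n + 1)) + normSq Ω (extrap X.q (n + 1)) - normSq Ω (X.q n)
      - normSq Ω (extrap X.q n)) ≤ 2 * P.dt * ∫ x in Ω,
        inner ℝ (bdf2 P.dt (X.q (n + 1) x) (X.q n x) (X.q (n - 1) x)) (X.q (n + 1) x) :=
    le_integral_inner_bdf2 q2 q1 q0 hdt
  have hδ : VecH1 Ω (fun x => bdf2 P.dt (X.d (n + 1) x) (X.d n x) (X.d (n - 1) x)) :=
    fun i => (d2 i).memH1_bdf2 (d1 i) (d0 i) P.dt
  have hpot := (hX.potential n h1 hn _ hδ).2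
  have hpen : ∫ x in Ω, X.q (n + 1) x * inner ℝ (extrap X.d n x)
        (bdf2 P.dt (X.d (n + 1) x) (X.d n x) (X.d (n - 1) x))
      = P.ε ^ 2 / 2 * ∫ x in Ω,
        inner ℝ (bdf2 P.dt (X.q (n + 1) x) (X.q n x) (X.q (n - 1) x)) (X.q (n + 1) x) := by
    rw [← integral_const_mul]
    refine integral_congr_ae ((hX.multiplier n h1 hn).mono fun x hx => ?_)
    simp only [hx, RCLike.inner_apply, conj_trivial]
    field_simp
  have hdir : (∫ x in Ω, inner ℝ (X.w (n + 1) x)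
        (bdf2 P.dt (X.d (n + 1) x) (X.d n x) (X.d (n - 1) x)))
      + savRatio P X.s (n + 1) * (∫ x in Ω,
        inner ℝ (advect Ω (extrap X.u n) (extrap X.d n) x) (X.w (n + 1) x))
      + P.γ * normSq Ω (X.w (n + 1)) = 0 := by
    have i1 := hw.integrable_inner hδ.memL2
    have i2 := (hX.sav n h1 hn).1.const_mul (savRatio P X.s (n + 1))
    have i3 := hw.integrable_norm_sq.const_mul P.γ
    have i12 : Integrable (fun x => inner ℝ (X.w (n + 1) x)
        (bdf2 P.dt (X.d (n + 1) x) (X.d n x) (X.d (n - 1) x)) + savRatio P X.s (n + 1) *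
        inner ℝ (advect Ω (extrap X.u n) (extrap X.d n) x) (X.w (n + 1) x))
        (volume.restrict Ω) := i1.add i2
    rw [normSq, ← integral_const_mul, ← integral_const_mul, ← integral_add i1 i2,
      ← integral_add i12 i3]
    -- The summed integrand is the transport equation paired pointwise with `w`.
    refine integral_eq_zero_of_ae ((hX.director n h1 hn).mono fun x hx => ?_)
    have h := congrArg (fun y => inner ℝ y (X.w (n + 1) x)) hx
    simp only [inner_add_left, inner_smul_left, conj_trivial, inner_zero_left,
      real_inner_self_eq_norm_sq] at h
    rw [Pi.zero_apply, ← h, real_inner_comm]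
  rw [hpot, hpen] at hdir
  have h2 := congrArg (fun y => 2 * P.dt * y) hdir
  have h3 := mul_le_mul_of_nonneg_left hq (by positivity : 0 ≤ P.ε ^ 2 / 2)
  simp only [mul_zero] at h2
  linarith

end Director

/-! ### The auxiliary variable and the assembled momentum balance -/

section Auxiliary

/-- Balance of the scalar auxiliary variable. -/
theorem IsSolution.sav_le (hX : IsSolution Ω P X) (hdt : 0 < P.dt) (h1 : 1 ≤ n)
    (hn : n + 1 ≤ P.N) :
    1 / 2 * (|X.s (n + 1)| ^ 2 + |extrap X.s (n + 1)| ^ 2 - |X.s n| ^ 2 - |extrap X.s n| ^ 2)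
      ≤ -(2 * P.dt / P.T * |X.s (n + 1)| ^ 2)
        + 2 * P.dt * (savRatio P X.s (n + 1) * ∫ x in Ω,
          inner ℝ (advect Ω (extrap X.u n) (extrap X.d n) x) (X.w (n + 1) x))
        - 2 * P.dt * (savRatio P X.s (n + 1) * ∫ x in Ω,
          inner ℝ (advect Ω (X.ustar (n + 1)) (extrap X.d n) x) (extrap X.w n x)) := by
  have h := congrArg (fun y => 2 * P.dt * (X.s (n + 1) * y)) (hX.sav n h1 hn).2.2
  have e : 2 * P.dt * (X.s (n + 1) * bdf2 P.dt (X.s (n + 1)) (X.s n) (X.s (n - 1)))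
      = X.s (n + 1) * (3 * X.s (n + 1) - 4 * X.s n + X.s (n - 1)) := by
    simp only [bdf2, smul_eq_mul]
    field_simp
  simp only [e] at h
  have hle : 1 / 2 * (|X.s (n + 1)| ^ 2 + |extrap X.s (n + 1)| ^ 2 - |X.s n| ^ 2
      - |extrap X.s n| ^ 2) ≤ X.s (n + 1) * (3 * X.s (n + 1) - 4 * X.s n + X.s (n - 1)) := by
    simp only [sq_abs, extrap, smul_eq_mul, Nat.add_sub_cancel]
    nlinarith [sq_nonneg (X.s (n + 1) - 2 * X.s n + X.s (n - 1))]
  rw [h] at hle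
  refine hle.trans_eq ?_
  simp only [savRatio, sq_abs]
  ring

/-- By transposition, the work of the elastic force on `u_*` becomes the second integral of the `s`
equation. -/
theorem inner_jacTMul (v w a : Pt m → Pt m) (x : Pt m) :
    inner ℝ (jacTMul Ω v w x) (a x) = inner ℝ (advect Ω a v x) (w x) := by
  simp only [PiLp.inner_apply, RCLike.inner_apply, conj_trivial, jacTMul, advect, Finset.mul_sum]
  rw [Finset.sum_comm]
  exact Finset.sum_congr rfl fun i _ => Finset.sum_congr rfl fun j _ => by ring

/-- Balance of the kinetic energy and of the pressure terms. -/
theorem IsSolution.momentum_le (hΩ : IsOpen Ω) (hX : IsSolution Ω P X) (hν : 0 < P.ν)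
    (hdt : 0 < P.dt) (h1 : 1 ≤ n) (hn : n + 1 ≤ P.N) :
    1 / 2 * (normSq Ω (X.u (n + 1)) + normSq Ω (extrap X.u (n + 1)) - normSq Ω (X.u n)
        - normSq Ω (extrap X.u n))
      + 2 / 3 * P.dt ^ 2 * (gradNormSq Ω (hSeq Ω P.ν X.ustar X.p (n + 1))
        - gradNormSq Ω (hSeq Ω P.ν X.ustar X.p n))
      + P.ν⁻¹ * P.dt * (normSq Ω (gSeq Ω P.ν X.ustar (n + 1)) - normSq Ω (gSeq Ω P.ν X.ustar n))
      + P.ν * P.dt * jacNormSq Ω (X.ustar (n + 1)) + P.ν * P.dt * curlNormSq Ω (X.ustar (n + 1))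
      ≤ 2 * P.dt * (P.lam * (savRatio P X.s (n + 1) * ∫ x in Ω,
          inner ℝ (advect Ω (X.ustar (n + 1)) (extrap X.d n) x) (extrap X.w n x))) := by
  have hU := hX.ustar_mem (n + 1) (by omega) hn
  have hH2 := hX.memH1_hSeq (n := n + 1) (by omega) hn
  have hH1 := hX.memH1_hSeq h1 (by omega)
  obtain ⟨-, -, -, hmom⟩ := hX.momentum n h1 hn _ hU
  obtain ⟨hc1, hc2⟩ := hX.convection_eq_zero hΩ h1 hn
  have hkin := hX.kinetic_le hdt h1 hn
  have hpr := hX.integral_pressure hΩ hν h1 hn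
  have hinc := hX.weakGrad_increment hΩ h1 hn
  have hcurl := hU.jacNormSq_eq hΩ
  have hjac : ∑ i, ∑ j, ∫ x in Ω, jac Ω (X.ustar (n + 1)) i j x * jac Ω (X.ustar (n + 1)) i j x
      = jacNormSq Ω (X.ustar (n + 1)) := by
    simp only [jacNormSq, normSq_eq_integral_mul]
  have hcross := two_mul_integral_inner_sub hH2.memL2_weakGrad hH1.memL2_weakGrad
  have hφ : ∫ x in Ω, inner ℝ (weakGrad Ω (hSeq Ω P.ν X.ustar X.p n) x)
        (weakGrad Ω (fun x => X.p (n + 1) x - X.p n x + P.ν * weakDiv Ω (X.ustar (n + 1)) x) x)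
      = ∫ x in Ω, inner ℝ (weakGrad Ω (hSeq Ω P.ν X.ustar X.p n) x)
        (weakGrad Ω (hSeq Ω P.ν X.ustar X.p (n + 1)) x
          - weakGrad Ω (hSeq Ω P.ν X.ustar X.p n) x) :=
    integral_congr_ae (hinc.mono fun x hx => by simp only [hx])
  rw [hX.integral_ustar_weakGrad hdt h1 hn hH1, hφ] at hpr
  rw [normSq_congr hinc] at hkin
  have hnn := normSq_nonneg (Ω := Ω) (fun x => weakGrad Ω (hSeq Ω P.ν X.ustar X.p (n + 1)) x
    - weakGrad Ω (hSeq Ω P.ν X.ustar X.p n) x)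
  simp only [hc1, hc2, inner_jacTMul, hjac] at hmom
  rw [hH2.gradNormSq_eq, hH1.gradNormSq_eq]
  have hmom' := congrArg (fun y => 2 * P.dt * y) hmom
  have hcross' := congrArg (fun y => 2 / 3 * P.dt ^ 2 * y) hcross
  have hcurl' := congrArg (fun y => P.ν * P.dt * y) hcurl
  -- Of the gain `4Δt²/3` from the projection, `2Δt²/3` pays for the cross term; this nonnegative
  -- remainder is discarded.
  have hnn' := mul_nonneg (by positivity : 0 ≤ 2 / 3 * P.dt ^ 2) hnn
  linarith

end Auxiliary

end PCSAV

/-! ### The energy inequality -/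

theorem theorem2p1 {m : ℕ} (hm : m = 2 ∨ m = 3)
    (Ω : Set (PCSAV.Pt m)) (hΩ : IsOpen Ω) (hΩb : Bornology.IsBounded Ω)
    (P : PCSAV.Params) (hν : 0 < P.ν) (hlam : 0 < P.lam) (hγ : 0 < P.γ) (hε : 0 < P.ε)
    (hT : 0 < P.T) (hN : 0 < P.N)
    (X : PCSAV.Iterates m) (hX : PCSAV.IsSolution Ω P X) :
    (∀ n, 1 ≤ n → n ≤ P.N → PCSAV.MemH1 Ω (PCSAV.hSeq Ω P.ν X.ustar X.p n)) ∧
    ∀ n, 1 ≤ n → n + 1 ≤ P.N →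
      PCSAV.energy Ω P X (n + 1) - PCSAV.energy Ω P X n ≤
        -(2 * P.dt * P.lam * P.γ * PCSAV.normSq Ω (X.w (n + 1)))
        - P.ν * P.dt * PCSAV.jacNormSq Ω (X.ustar (n + 1))
        - P.ν * P.dt * PCSAV.curlNormSq Ω (X.ustar (n + 1))
        - 2 * P.dt / P.T * P.lam * |X.s (n + 1)| ^ 2 := by
  refine ⟨fun n h1 hn => hX.memH1_hSeq h1 hn, fun n h1 hn => ?_⟩
  have hdt := PCSAV.Params.dt_pos hT hN
  have hu := hX.momentum_le hΩ hν hdt h1 hn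
  have hd := mul_le_mul_of_nonneg_left (hX.director_le hΩ hdt hε h1 hn) hlam.le
  have hs := mul_le_mul_of_nonneg_left (hX.sav_le hdt h1 hn) hlam.le
  simp only [PCSAV.energy]
  -- With the director and `s` balances weighted by `λ`, both coupling integrals cancel in the sum.
  linarith
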